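/- Conventions. A directed graph is a nonempty set $V$ with a binary edge relation $E$ on $V$, i.e. a nonempty structure of the vocabulary $\{E\}$. Formulas of $(\mathrm{FO}+\mathrm{LFP})$ are built from atomic formulas (including atoms $P(\bar t)$ for relation variables $P$) by the first-order constructors and by the following one: if $\varphi(P,\bar a,x_1,\dots,x_r)$ is a formula with parameters $\bar a$ (and possibly further relation variables) in which the $r$-ary relation variable $P$ has only positive occurrences, then $[\mathrm{LFP}_{P;x_1,\dots,x_r}\,\varphi](t_1,\dots,t_r)$ is a formula. In a finite structure $M$, for given values of the parameters, let $P_0=\emptyset$ and $P_{k+1}=\{\bar x : M\models\varphi(P_k,\bar a,\bar x)\}$; the formula says that $(t_1,\dots,t_r)\in\bigcup_k P_k$. A formula of $(\mathrm{FO}+\mathrm{LFP})$ over $\{E\}$ may have free individual variables but has no free relation variables. Theorem. There is a sequence $G_1,G_2,\dots$ of finite directed graphs such that the class $\mathcal G$ of all directed graphs isomorphic to some $G_j$ has the following two properties. 1. $\mathcal G$ admits positive elementary inductions (fixed points) of unbounded depth: there is a first-order formula $\varphi(P,\bar a,\bar x)$ of vocabulary $\{E,P\}$, with only positive occurrences of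 the relation symbol $P$, whose arity is the length of $\bar x$, such that for every $j$ there are a graph $M\in\mathcal G$ and values in $M$ of the parameters $\bar a$ for which $P_j\neq\bigcup_k P_k$. 2. Every $(\mathrm{FO}+\mathrm{LFP})$ formula $\varphi(y_1,\dots,y_n)$ over $\{E\}$, $n\ge 0$, is equivalent in $\mathcal G$ to a first-order formula: there is a first-order formula $\psi(y_1,\dots,y_n)$ over $\{E\}$ such that $M\models\varphi(\bar b)\Leftrightarrow M\models\psi(\bar b)$ for all $M\in\mathcal G$ and all $\bar b\in M^n$. So, for classes $K$ of finite structures closed under isomorphism, the condition "every $(\mathrm{FO}+\mathrm{LFP})$ formula is equivalent to a first-order formula in $K$" (M2) does not imply "every positive elementary induction is bounded in $K$" (M1), which refutes McColm's conjecture. -/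

import Mathlib

/-!
First-order logic with the least fixed point operator, (FO + LFP), on finite structures.
First-order formulas, structures and isomorphisms are those of `FirstOrder.Language`.
-/

universe u v

namespace McColm

open scoped FirstOrder

/-- Formulas of first-order logic with relation variables and fixed point operators, over the
vocabulary `L`. `Γ` is the list of the arities of the relation variables in scope, and the
individual variables in scope are indexed by `Fin n`. Disjunction, implication and the universal
quantifier are the usual abbreviations.

In `lfp r φ ts`, the formula `φ` has a new relation variable `P` of arity `r` (number `0` in the
list) and `r` new individual variables (the last `r` of the `n + r` ones), and
`lfp r φ ts` is `[LFP_{P; x_1, …, x_r} φ] (t_1, …, t_r)`. The first `n` variables of `φ` and the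
other relation variables are parameters. -/
inductive Fml (L : FirstOrder.Language.{u, v}) : List ℕ → ℕ → Type (max u v)
  | equal {Γ : List ℕ} {n : ℕ} (t₁ t₂ : L.Term (Fin n)) : Fml L Γ n
  | rel {Γ : List ℕ} {n k : ℕ} (R : L.Relations k) (ts : Fin k → L.Term (Fin n)) : Fml L Γ n
  | relVar {Γ : List ℕ} {n : ℕ} (i : Fin Γ.length) (ts : Fin (Γ.get i) → L.Term (Fin n)) :
      Fml L Γ n
  | neg {Γ : List ℕ} {n : ℕ} (φ : Fml L Γ n) : Fml L Γ n
  | and {Γ : List ℕ} {n : ℕ} (φ ψ : Fml L Γ n) : Fml L Γ n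
  | ex {Γ : List ℕ} {n : ℕ} (φ : Fml L Γ (n + 1)) : Fml L Γ n
  | lfp {Γ : List ℕ} {n : ℕ} (r : ℕ) (φ : Fml L (r :: Γ) (n + r))
      (ts : Fin r → L.Term (Fin n)) : Fml L Γ n

/-- The values of the relation variables in `Γ`: one relation on `M` for each, of its arity. -/
abbrev RelEnv (M : Type*) (Γ : List ℕ) : Type _ :=
  (i : Fin Γ.length) → Set (Fin (Γ.get i) → M)

/-- Add the value of a new relation variable in front. -/
def RelEnv.cons {M : Type*} {Γ : List ℕ} {r : ℕ} (P : Set (Fin r → M)) (ρ : RelEnv M Γ) :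
    RelEnv M (r :: Γ) :=
  Fin.cons (α := fun i : Fin (Γ.length + 1) => Set (Fin ((r :: Γ).get i) → M)) P ρ

/-- The only environment for the empty list of relation variables. -/
def RelEnv.nil {M : Type*} : RelEnv M [] := fun i => i.elim0

/-- The stage `P_k` of the induction with operator `F`: `P_0 = ∅` and `P_{k+1} = F P_k`. -/
def stage {α : Type*} (F : Set α → Set α) : ℕ → Set α
  | 0 => ∅
  | k + 1 => F (stage F k)

namespace Fml

variable {L : FirstOrder.Language.{u, v}}

/-- Satisfaction. The fixed point is the union of the stages, as usual on finite structures. -/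
def Realize {M : Type*} [L.Structure M] : {Γ : List ℕ} → {n : ℕ} →
    Fml L Γ n → RelEnv M Γ → (Fin n → M) → Prop
  | _, _, equal t₁ t₂, _, a => t₁.realize a = t₂.realize a
  | _, _, rel R ts, _, a => FirstOrder.Language.Structure.RelMap R (fun i => (ts i).realize a)
  | _, _, relVar i ts, ρ, a => (fun l => (ts l).realize a) ∈ ρ i
  | _, _, neg φ, ρ, a => ¬ φ.Realize ρ a
  | _, _, and φ ψ, ρ, a => φ.Realize ρ a ∧ ψ.Realize ρ a
  | _, _, ex φ, ρ, a => ∃ x : M, φ.Realize ρ (Fin.snoc a x)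
  | _, _, lfp r φ ts, ρ, a =>
      (fun l => (ts l).realize a) ∈
        ⋃ k : ℕ, stage (fun P : Set (Fin r → M) =>
          {x | φ.Realize (RelEnv.cons P ρ) (Fin.append a x)}) k

/-- `φ.Polarity b i`: all free occurrences of the relation variable `i` in `φ` are positive
(in the scope of an even number of negations) if `b = true`, and negative if `b = false`. -/
def Polarity : {Γ : List ℕ} → {n : ℕ} → Fml L Γ n → Bool → Fin Γ.length → Prop
  | _, _, equal _ _, _, _ => True
  | _, _, rel _ _, _, _ => True
  | _, _, relVar j _, b, i => j = i → b = true
  | _, _, neg φ, b, i => φ.Polarity (!b) i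
  | _, _, and φ ψ, b, i => φ.Polarity b i ∧ ψ.Polarity b i
  | _, _, ex φ, b, i => φ.Polarity b i
  | _, _, lfp _ φ _, b, i => φ.Polarity b i.succ

/-- The formulas of (FO + LFP): each LFP operator is applied to a formula in which the relation
variable that it binds has only positive occurrences. -/
def IsLFP : {Γ : List ℕ} → {n : ℕ} → Fml L Γ n → Prop
  | _, _, equal _ _ => True
  | _, _, rel _ _ => True
  | _, _, relVar _ _ => True
  | _, _, neg φ => φ.IsLFP
  | _, _, and φ ψ => φ.IsLFP ∧ ψ.IsLFP
  | _, _, ex φ => φ.IsLFP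
  | Γ, _, lfp _ φ _ => φ.Polarity true (0 : Fin (Γ.length + 1)) ∧ φ.IsLFP

/-- The first-order formulas: no LFP operator occurs. -/
def IsFO : {Γ : List ℕ} → {n : ℕ} → Fml L Γ n → Prop
  | _, _, equal _ _ => True
  | _, _, rel _ _ => True
  | _, _, relVar _ _ => True
  | _, _, neg φ => φ.IsFO
  | _, _, and φ ψ => φ.IsFO ∧ ψ.IsFO
  | _, _, ex φ => φ.IsFO
  | _, _, lfp _ _ _ => False

/-- The operator `P ↦ {x | M ⊨ φ(P, a, x)}` that `φ(P, a, x)` with parameters `a` defines. -/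
def operator {M : Type*} [L.Structure M] {s r : ℕ} (φ : Fml L [r] (s + r)) (a : Fin s → M) :
    Set (Fin r → M) → Set (Fin r → M) :=
  fun P => {x | φ.Realize (RelEnv.cons P RelEnv.nil) (Fin.append a x)}

end Fml

/-- Finite nonempty structures of vocabulary `L`. -/
structure FinStructure (L : FirstOrder.Language.{u, v}) where
  carrier : Type
  str : L.Structure carrier
  fin : Finite carrier
  nonempty : Nonempty carrier

instance (L : FirstOrder.Language.{u, v}) (M : FinStructure L) : L.Structure M.carrier := M.str

instance (L : FirstOrder.Language.{u, v}) (M : FinStructure L) : Finite M.carrier := M.fin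

instance (L : FirstOrder.Language.{u, v}) (M : FinStructure L) : Nonempty M.carrier := M.nonempty

/-- The closure under isomorphism of the set of the structures `G 0, G 1, …`. -/
def isoClass {L : FirstOrder.Language.{u, v}} (G : ℕ → FinStructure L) : Set (FinStructure L) :=
  {M | ∃ j, Nonempty (M.carrier ≃[L] (G j).carrier)}

/-- M1: every positive elementary induction is bounded in `K`. That is, for every first-order
formula `φ(P, a, x)` with only positive occurrences of `P` there is a `j` such that the induction
is complete at stage `j`, in every structure of `K` and for all values of the parameters. -/
def InductionsBounded {L : FirstOrder.Language.{u, v}} (K : Set (FinStructure L)) : Prop :=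
  ∀ (s r : ℕ) (φ : Fml L [r] (s + r)),
    φ.IsFO → φ.Polarity true (0 : Fin 1) →
    ∃ j : ℕ, ∀ M ∈ K, ∀ a : Fin s → M.carrier,
      stage (φ.operator a) j = ⋃ k : ℕ, stage (φ.operator a) k

/-- M2: every (FO + LFP) formula is equivalent to a first-order formula in `K`. -/
def LFPCollapsesToFO {L : FirstOrder.Language.{u, v}} (K : Set (FinStructure L)) : Prop :=
  ∀ (n : ℕ) (φ : Fml L [] n), φ.IsLFP →
    ∃ ψ : L.Formula (Fin n), ∀ M ∈ K, ∀ a : Fin n → M.carrier,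
      φ.Realize RelEnv.nil a ↔ ψ.Realize a

/-- Finite directed graphs: finite structures with one binary relation. -/
abbrev FinDigraph : Type 1 := FinStructure FirstOrder.Language.graph

end McColm

/-!
The digraph number `N` consists of `N + 1` parts and of a chain, a reflexive linear order of
`N + 1` colours. The chain makes the inductions unbounded. Every vertex of a part has a colour, the
only element of the chain to which it points, and the parts can be told apart by the sizes of their
largest transitive tournaments: in part `j` this is `2 * T j`, where `T` grows fast. In a special
tournament of this size, the colours of the vertices, read in the order of the tournament, spell
out a tuple of colours.

List the queries that are to become definable. Part `i` has a special tournament for the code of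
each tuple of elements that satisfies query `i`, the code being a tuple of colours that describes
the elements with regard to the earlier parts. There is no circularity: the edges inside the parts,
where they are possible at all, are those of a relation so rich in extensions (it is found by
counting) that `T i` pebbles cannot see what is recorded in the parts from number `i` on, so query
`i`, being invariant under the pebble game with `T i` pebbles, has the same value whether or not
these records are there. Hence the first-order formula that says that the code of a tuple is
recorded in part `i` expresses query `i` in all but finitely many of the digraphs, and the
exceptions can be described up to isomorphism.

Formulas of (FO + LFP) are invariant under the game with as many pebbles as they have variables:
the recursion only rearranges pebbles, since the stages of the induction are themselves invariant.
-/

namespace McColm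

open FirstOrder FirstOrder.Language FirstOrder.Language.Structure

section Invariance

variable {L : FirstOrder.Language.{u, v}}

/-- A back-and-forth system for the pebble game with `K` pebbles between `M` and `M'`: a relation
between tuples of `M` and of `M'` of the same length, closed under `Fin`-reindexing, whose members
are partial isomorphisms, and with the back-and-forth property for tuples of length less than `K`.
There is no bound on the length of the related tuples. -/
structure PebbleSystem (L : FirstOrder.Language.{u, v}) (M M' : Type*) [L.Structure M]
    [L.Structure M'] (K : ℕ) where
  rel : ∀ {n : ℕ}, (Fin n → M) → (Fin n → M') → Prop
  reindex : ∀ {m n : ℕ} {a : Fin n → M} {b : Fin n → M'}, rel a b →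
    ∀ f : Fin m → Fin n, rel (a ∘ f) (b ∘ f)
  eq_iff : ∀ {n : ℕ} {a : Fin n → M} {b : Fin n → M'}, rel a b → ∀ i j, a i = a j ↔ b i = b j
  relMap_iff : ∀ {n : ℕ} {a : Fin n → M} {b : Fin n → M'}, rel a b →
    ∀ {k : ℕ} (R : L.Relations k) (f : Fin k → Fin n), RelMap R (a ∘ f) ↔ RelMap R (b ∘ f)
  forth : ∀ {n : ℕ} {a : Fin n → M} {b : Fin n → M'}, n + 1 ≤ K → rel a b →
    ∀ x, ∃ y, rel (Fin.snoc a x : Fin (n + 1) → M) (Fin.snoc b y : Fin (n + 1) → M')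
  back : ∀ {n : ℕ} {a : Fin n → M} {b : Fin n → M'}, n + 1 ≤ K → rel a b →
    ∀ y, ∃ x, rel (Fin.snoc a x : Fin (n + 1) → M) (Fin.snoc b y : Fin (n + 1) → M')

/-- A global `n`-ary relation (a query) on the structures of vocabulary `L`. It need not be
definable in any logic, nor even invariant under isomorphisms. -/
abbrev Query (L : FirstOrder.Language.{u, v}) (n : ℕ) : Type _ :=
  ∀ (M : Type) [L.Structure M], (Fin n → M) → Prop

/-- A query that `K` pebbles cannot distinguish: it is preserved by all back-and-forth systems for
the pebble game with `K` pebbles. -/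
def Query.IsPebbleInvariant {n : ℕ} (Q : Query L n) (K : ℕ) : Prop :=
  ∀ (M M' : Type) [L.Structure M] [L.Structure M'] (S : PebbleSystem L M M' K) (a : Fin n → M)
    (b : Fin n → M'), S.rel a b → (Q M a ↔ Q M' b)

/-- The largest number of individual variables in the scope of an `ex` in a formula. Recursion by
LFP counts for nothing: it moves pebbles, but does not place new ones. -/
def Fml.width : {Γ : List ℕ} → {n : ℕ} → Fml L Γ n → ℕ
  | _, _, .equal _ _ => 0
  | _, _, .rel _ _ => 0
  | _, _, .relVar _ _ => 0
  | _, _, .neg φ => φ.width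
  | _, _, .and φ ψ => max φ.width ψ.width
  | _, n, .ex φ => max (n + 1) φ.width
  | _, _, .lfp _ φ _ => φ.width

/-- The variable that a term of a relational language is. -/
def termVar [L.IsRelational] {α : Type*} : L.Term α → α
  | .var x => x
  | .func f _ => isEmptyElim f

theorem realize_eq_termVar [L.IsRelational] {α M : Type*} [L.Structure M] (t : L.Term α)
    (a : α → M) : t.realize a = a (termVar t) := by
  cases t with
  | var x => rfl
  | func f _ => exact isEmptyElim f

theorem realize_eq_comp_termVar [L.IsRelational] {α M : Type*} [L.Structure M] {k : ℕ}
    (ts : Fin k → L.Term α) (a : α → M) :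
    (fun l => (ts l).realize a) = a ∘ fun l => termVar (ts l) :=
  funext fun l => realize_eq_termVar (ts l) a

theorem comp_append {α β : Type*} {m n : ℕ} (g : α → β) (e : Fin m → α) (f : Fin n → α) :
    g ∘ Fin.append e f = Fin.append (g ∘ e) (g ∘ f) := by
  ext i
  cases i using Fin.addCases <;> simp

namespace PebbleSystem

variable {M M' : Type*} [L.Structure M] [L.Structure M'] {K : ℕ} (S : PebbleSystem L M M' K)

theorem rel_append {n p r : ℕ} {a : Fin n → M} {b : Fin n → M'} (hab : S.rel a b)
    (e : Fin p → Fin n) (f : Fin r → Fin n) :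
    S.rel (Fin.append (a ∘ e) (a ∘ f)) (Fin.append (b ∘ e) (b ∘ f)) := by
  simpa only [comp_append] using S.reindex hab (Fin.append e f)

theorem exists_iff {n : ℕ} {a : Fin n → M} {b : Fin n → M'} (hn : n + 1 ≤ K) (hab : S.rel a b)
    {p : M → Prop} {p' : M' → Prop}
    (h : ∀ x y, S.rel (Fin.snoc a x : Fin (n + 1) → M) (Fin.snoc b y : Fin (n + 1) → M') →
      (p x ↔ p' y)) :
    (∃ x, p x) ↔ ∃ y, p' y := by
  constructor
  · rintro ⟨x, hx⟩
    obtain ⟨y, hxy⟩ := S.forth hn hab x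
    exact ⟨y, (h x y hxy).1 hx⟩
  · rintro ⟨y, hy⟩
    obtain ⟨x, hxy⟩ := S.back hn hab y
    exact ⟨x, (h x y hxy).2 hy⟩

/-- Two sets of `r`-tuples that correspond to each other under the system, relative to values `a`
and `b` of parameters. -/
def SetRel {n r : ℕ} (a : Fin n → M) (b : Fin n → M') (P : Set (Fin r → M))
    (P' : Set (Fin r → M')) : Prop :=
  ∀ u w, S.rel (Fin.append a u) (Fin.append b w) → (u ∈ P ↔ w ∈ P')

/-- Two values of the relation variables that correspond to each other, relative to values `a` and
`b` of the individual variables. Only some of these may serve as parameters of a given relation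
variable, so that the correspondence survives when new individual variables come into scope. -/
def EnvRel {Γ : List ℕ} {n : ℕ} (ρ : RelEnv M Γ) (ρ' : RelEnv M' Γ) (a : Fin n → M)
    (b : Fin n → M') : Prop :=
  ∀ i, ∃ (p : ℕ) (e : Fin p → Fin n), S.SetRel (a ∘ e) (b ∘ e) (ρ i) (ρ' i)

variable {S}

theorem EnvRel.of_comp {Γ : List ℕ} {n m : ℕ} {ρ : RelEnv M Γ} {ρ' : RelEnv M' Γ} {a : Fin m → M}
    {b : Fin m → M'} (f : Fin n → Fin m) (h : S.EnvRel ρ ρ' (a ∘ f) (b ∘ f)) :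
    S.EnvRel ρ ρ' a b := fun i =>
  let ⟨p, e, he⟩ := h i
  ⟨p, f ∘ e, he⟩

theorem EnvRel.snoc {Γ : List ℕ} {n : ℕ} {ρ : RelEnv M Γ} {ρ' : RelEnv M' Γ} {a : Fin n → M}
    {b : Fin n → M'} (h : S.EnvRel ρ ρ' a b) (x : M) (y : M') :
    S.EnvRel ρ ρ' (Fin.snoc a x : Fin (n + 1) → M) (Fin.snoc b y : Fin (n + 1) → M') :=
  .of_comp Fin.castSucc <| by simpa only [Fin.snoc_comp_castSucc] using h

theorem EnvRel.append {Γ : List ℕ} {n r : ℕ} {ρ : RelEnv M Γ} {ρ' : RelEnv M' Γ} {a : Fin n → M}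
    {b : Fin n → M'} (h : S.EnvRel ρ ρ' a b) (u : Fin r → M) (w : Fin r → M') :
    S.EnvRel ρ ρ' (Fin.append a u) (Fin.append b w) := by
  refine .of_comp (Fin.castAdd r) ?_
  convert h <;> ext i <;> simp

theorem EnvRel.cons {Γ : List ℕ} {n r : ℕ} {ρ : RelEnv M Γ} {ρ' : RelEnv M' Γ} {a : Fin n → M}
    {b : Fin n → M'} (h : S.EnvRel ρ ρ' a b) {P : Set (Fin r → M)} {P' : Set (Fin r → M')}
    (hP : S.SetRel a b P P') : S.EnvRel (RelEnv.cons P ρ) (RelEnv.cons P' ρ') a b :=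
  Fin.cases ⟨n, id, hP⟩ h

theorem SetRel.stage {n r : ℕ} {a : Fin n → M} {b : Fin n → M'}
    {F : Set (Fin r → M) → Set (Fin r → M)} {F' : Set (Fin r → M') → Set (Fin r → M')}
    (h : ∀ P P', S.SetRel a b P P' → S.SetRel a b (F P) (F' P')) (k : ℕ) :
    S.SetRel a b (stage F k) (stage F' k) := by
  induction k with
  | zero => exact fun _ _ _ => Iff.rfl
  | succ k ih => exact h _ _ ih

theorem SetRel.iUnion {n r : ℕ} {a : Fin n → M} {b : Fin n → M'} {P : ℕ → Set (Fin r → M)}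
    {P' : ℕ → Set (Fin r → M')} (h : ∀ k, S.SetRel a b (P k) (P' k)) :
    S.SetRel a b (⋃ k, P k) (⋃ k, P' k) := fun u w huw => by
  simpa only [Set.mem_iUnion] using exists_congr fun k => h k u w huw

variable (S)

theorem realize_iff [L.IsRelational] {Γ : List ℕ} {n : ℕ} (φ : Fml L Γ n) (hφ : φ.width ≤ K)
    {ρ : RelEnv M Γ} {ρ' : RelEnv M' Γ} {a : Fin n → M} {b : Fin n → M'} (hab : S.rel a b)
    (hρ : S.EnvRel ρ ρ' a b) : φ.Realize ρ a ↔ φ.Realize ρ' b := by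
  induction φ with
  | equal t₁ t₂ =>
    simpa only [Fml.Realize, realize_eq_termVar] using S.eq_iff hab _ _
  | rel R ts =>
    simpa only [Fml.Realize, realize_eq_comp_termVar] using S.relMap_iff hab R _
  | relVar i ts =>
    simp only [Fml.Realize, realize_eq_comp_termVar]
    obtain ⟨p, e, he⟩ := hρ i
    exact he _ _ (S.rel_append hab e _)
  | neg φ ih => exact not_congr (ih hφ hab hρ)
  | and φ ψ ihφ ihψ =>
    obtain ⟨hφ, hψ⟩ := max_le_iff.1 hφ
    exact and_congr (ihφ hφ hab hρ) (ihψ hψ hab hρ)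
  | ex φ ih =>
    obtain ⟨hn, hφ⟩ := max_le_iff.1 hφ
    exact S.exists_iff hn hab fun x y hxy => ih hφ hxy (hρ.snoc x y)
  | lfp r φ ts ih =>
    simp only [Fml.Realize, realize_eq_comp_termVar]
    refine SetRel.iUnion (SetRel.stage fun P P' hP u w huw => ?_) _ _ (S.rel_append hab id _)
    exact ih hφ huw ((hρ.cons hP).append u w)

theorem exists_rel {a₀ : Fin 0 → M} {b₀ : Fin 0 → M'} (h₀ : S.rel a₀ b₀) {n : ℕ} (hn : n ≤ K)
    (a : Fin n → M) : ∃ b, S.rel a b := by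
  induction n with
  | zero => exact ⟨b₀, Subsingleton.elim a₀ a ▸ h₀⟩
  | succ n ih =>
    obtain ⟨b, hb⟩ := ih (n.le_succ.trans hn) (a ∘ Fin.castSucc)
    obtain ⟨y, hy⟩ := S.forth hn hb (a (Fin.last n))
    exact ⟨_, Fin.snoc_init_self a ▸ hy⟩

/-- A back-and-forth system for the game with fewer pebbles. -/
def ofLE {K' : ℕ} (h : K' ≤ K) : PebbleSystem L M M' K' where
  rel := S.rel
  reindex := S.reindex
  eq_iff := S.eq_iff
  relMap_iff := S.relMap_iff
  forth hn := S.forth (hn.trans h)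
  back hn := S.back (hn.trans h)

/-- An isomorphism is a back-and-forth system for every number of pebbles. -/
def ofEquiv (f : M ≃[L] M') (K : ℕ) : PebbleSystem L M M' K where
  rel a b := f ∘ a = b
  reindex := by rintro _ _ _ _ rfl g; rfl
  eq_iff := by rintro _ _ _ rfl i j; exact f.injective.eq_iff.symm
  relMap_iff := by rintro _ _ _ rfl _ R g; exact (f.map_rel R _).symm
  forth := by rintro _ _ _ - rfl x; exact ⟨f x, Fin.comp_snoc f _ x⟩
  back := by
    rintro _ a _ - rfl y
    exact ⟨f.symm y, (Fin.comp_snoc f a _).trans (by rw [f.apply_symm_apply])⟩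

end PebbleSystem

theorem Query.IsPebbleInvariant.mono {n K K' : ℕ} {Q : Query L n} (hQ : Q.IsPebbleInvariant K)
    (h : K ≤ K') : Q.IsPebbleInvariant K' := fun M M' _ _ S => hQ M M' (S.ofLE h)

theorem Query.IsPebbleInvariant.iff_of_equiv {n K : ℕ} {Q : Query L n} (hQ : Q.IsPebbleInvariant K)
    {M M' : Type} [L.Structure M] [L.Structure M'] (f : M ≃[L] M') (a : Fin n → M) :
    Q M a ↔ Q M' (f ∘ a) :=
  hQ M M' (.ofEquiv f K) a _ rfl

/-- The query that a formula defines. -/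
def Fml.query {n : ℕ} (φ : Fml L [] n) : Query L n := fun _ _ a => φ.Realize RelEnv.nil a

theorem Fml.isPebbleInvariant_query [L.IsRelational] {n : ℕ} (φ : Fml L [] n) :
    φ.query.IsPebbleInvariant φ.width := fun _ _ _ _ S _ _ hab =>
  S.realize_iff φ le_rfl hab fun i => i.elim0

end Invariance

section Countability

variable {L : FirstOrder.Language.{u, v}}

/-- A numbering of the formulas over a countable vocabulary. -/
def Fml.number [∀ n, Encodable (L.Term (Fin n))] [∀ n, Encodable (L.Relations n)] :
    {Γ : List ℕ} → {n : ℕ} → Fml L Γ n → ℕ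
  | _, _, .equal t₁ t₂ => Nat.pair 0 (Encodable.encode (t₁, t₂))
  | _, _, .rel (k := k) R ts => Nat.pair 1 (Nat.pair k (Encodable.encode (R, ts)))
  | _, _, .relVar i ts => Nat.pair 2 (Nat.pair i (Encodable.encode ts))
  | _, _, .neg φ => Nat.pair 3 φ.number
  | _, _, .and φ ψ => Nat.pair 4 (Nat.pair φ.number ψ.number)
  | _, _, .ex φ => Nat.pair 5 φ.number
  | _, _, .lfp r φ ts => Nat.pair 6 (Nat.pair r (Nat.pair φ.number (Encodable.encode ts)))

theorem Fml.number_injective [∀ n, Encodable (L.Term (Fin n))] [∀ n, Encodable (L.Relations n)]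
    {Γ : List ℕ} {n : ℕ} : Function.Injective (Fml.number : Fml L Γ n → ℕ) := by
  intro φ ψ h
  induction φ <;> cases ψ <;> simp only [number, Nat.pair_eq_pair, Fin.val_inj] at h <;>
    first | omega | skip
  case equal.equal => simpa using h.2
  case rel.rel =>
    obtain ⟨-, rfl, h⟩ := h
    simpa using h
  case relVar.relVar =>
    obtain ⟨-, rfl, h⟩ := h
    simpa using h
  case neg.neg ih _ => exact congrArg _ (ih h.2)
  case and.and ihφ ihψ _ _ => rw [ihφ h.2.1, ihψ h.2.2]
  case ex.ex ih _ => exact congrArg _ (ih h.2)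
  case lfp.lfp ih _ _ _ =>
    obtain ⟨-, rfl, h, h'⟩ := h
    rw [ih h, Encodable.encode_injective h']

instance Fml.countable [∀ n, Countable (L.Term (Fin n))] [∀ n, Countable (L.Relations n)]
    {Γ : List ℕ} {n : ℕ} : Countable (Fml L Γ n) :=
  have := fun n => Encodable.ofCountable (L.Term (Fin n))
  have := fun n => Encodable.ofCountable (L.Relations n)
  Fml.number_injective.countable

end Countability

section Definability

variable {L : FirstOrder.Language.{u, v}} {ι : Type*} (G : ι → Type*) [∀ i, L.Structure (G i)]

variable (L) in
/-- A family of relations, one on each of the structures `G i`, that is defined by a single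
first-order formula. -/
def UniformlyDefinable {α : Type} (R : ∀ i, (α → G i) → Prop) : Prop :=
  ∃ ψ : L.Formula α, ∀ i a, R i a ↔ ψ.Realize a

variable {G} {α β : Type}

namespace UniformlyDefinable

theorem congr {R R' : ∀ i, (α → G i) → Prop} (h : UniformlyDefinable L G R)
    (hR : ∀ i a, R' i a ↔ R i a) : UniformlyDefinable L G R' :=
  h.imp fun _ hψ i a => (hR i a).trans (hψ i a)

theorem eq (x y : α) : UniformlyDefinable L G fun i (a : α → G i) => a x = a y :=
  ⟨(Term.var x).equal (Term.var y), fun i a => by simp [Formula.realize_equal]⟩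

theorem not {R : ∀ i, (α → G i) → Prop} (h : UniformlyDefinable L G R) :
    UniformlyDefinable L G fun i a => ¬ R i a := by
  obtain ⟨ψ, hψ⟩ := h
  exact ⟨ψ.not, fun i a => (not_congr (hψ i a)).trans Formula.realize_not.symm⟩

theorem and {R R' : ∀ i, (α → G i) → Prop} (h : UniformlyDefinable L G R)
    (h' : UniformlyDefinable L G R') : UniformlyDefinable L G fun i a => R i a ∧ R' i a := by
  obtain ⟨ψ, hψ⟩ := h
  obtain ⟨ψ', hψ'⟩ := h'
  exact ⟨ψ ⊓ ψ', fun i a =>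
    (and_congr (hψ i a) (hψ' i a)).trans Formula.realize_inf.symm⟩

theorem or {R R' : ∀ i, (α → G i) → Prop} (h : UniformlyDefinable L G R)
    (h' : UniformlyDefinable L G R') : UniformlyDefinable L G fun i a => R i a ∨ R' i a :=
  (h.not.and h'.not).not.congr fun i a => by tauto

theorem imp {R R' : ∀ i, (α → G i) → Prop} (h : UniformlyDefinable L G R)
    (h' : UniformlyDefinable L G R') : UniformlyDefinable L G fun i a => R i a → R' i a :=
  (h.not.or h').congr fun i a => by tauto

theorem iff {R R' : ∀ i, (α → G i) → Prop} (h : UniformlyDefinable L G R)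
    (h' : UniformlyDefinable L G R') : UniformlyDefinable L G fun i a => R i a ↔ R' i a :=
  ((h.imp h').and (h'.imp h)).congr fun _ _ => iff_iff_implies_and_implies

theorem const (p : Prop) : UniformlyDefinable L G fun i (_ : α → G i) => p := by
  by_cases hp : p
  · exact ⟨⊤, fun i a => by simp [hp]⟩
  · exact ⟨⊥, fun i a => by simp [hp]⟩

theorem forall_index [Finite β] {R : β → ∀ i, (α → G i) → Prop}
    (h : ∀ b, UniformlyDefinable L G (R b)) : UniformlyDefinable L G fun i a => ∀ b, R b i a := by
  choose ψ hψ using h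
  exact ⟨Formula.iInf ψ, fun i a => by simp only [Formula.realize_iInf, hψ]⟩

theorem exists_index [Finite β] {R : β → ∀ i, (α → G i) → Prop}
    (h : ∀ b, UniformlyDefinable L G (R b)) : UniformlyDefinable L G fun i a => ∃ b, R b i a := by
  choose ψ hψ using h
  exact ⟨Formula.iSup ψ, fun i a => by simp only [Formula.realize_iSup, hψ]⟩

theorem exists_tuple [Finite β] {R : ∀ i, (α → G i) → (β → G i) → Prop}
    (h : UniformlyDefinable L G fun i (a : α ⊕ β → G i) =>
      R i (fun x => a (.inl x)) fun y => a (.inr y)) :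
    UniformlyDefinable L G fun i a => ∃ b, R i a b := by
  obtain ⟨ψ, hψ⟩ := h
  refine ⟨ψ.iExs β, fun i a => ?_⟩
  rw [Formula.realize_iExs]
  exact exists_congr fun b => hψ i (Sum.elim a b)

theorem exists_elem {R : ∀ i, (α → G i) → G i → Prop}
    (h : UniformlyDefinable L G fun i (a : α ⊕ Unit → G i) =>
      R i (fun x => a (.inl x)) (a (.inr ()))) :
    UniformlyDefinable L G fun i a => ∃ b, R i a b :=
  (exists_tuple (R := fun i a b => R i a (b ())) h).congr fun _ _ =>
    ⟨fun ⟨b, hb⟩ => ⟨fun _ => b, hb⟩, fun ⟨b, hb⟩ => ⟨b (), hb⟩⟩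

theorem forall_tuple [Finite β] {R : ∀ i, (α → G i) → (β → G i) → Prop}
    (h : UniformlyDefinable L G fun i (a : α ⊕ β → G i) =>
      R i (fun x => a (.inl x)) fun y => a (.inr y)) :
    UniformlyDefinable L G fun i a => ∀ b, R i a b :=
  (exists_tuple (R := fun i a b => ¬ R i a b) h.not).not.congr fun _ _ => not_exists_not.symm

theorem forall_elem {R : ∀ i, (α → G i) → G i → Prop}
    (h : UniformlyDefinable L G fun i (a : α ⊕ Unit → G i) =>
      R i (fun x => a (.inl x)) (a (.inr ()))) :
    UniformlyDefinable L G fun i a => ∀ b, R i a b :=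
  (exists_elem (R := fun i a b => ¬ R i a b) h.not).not.congr fun _ _ => not_exists_not.symm

end UniformlyDefinable

end Definability

section Digraphs

/-- The edge relation of a directed graph. -/
def Edge {M : Type*} [Language.graph.Structure M] (x y : M) : Prop := RelMap adj ![x, y]

theorem relMap_comp_iff_of_edge_iff {M M' : Type*} [Language.graph.Structure M]
    [Language.graph.Structure M'] {α : Type*} {a : α → M} {b : α → M'}
    (h : ∀ i j, Edge (a i) (a j) ↔ Edge (b i) (b j)) {k : ℕ} (R : Language.graph.Relations k)
    (f : Fin k → α) : RelMap R (a ∘ f) ↔ RelMap R (b ∘ f) := by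
  cases R
  have ha : a ∘ f = ![a (f 0), a (f 1)] := by ext i; fin_cases i <;> rfl
  have hb : b ∘ f = ![b (f 0), b (f 1)] := by ext i; fin_cases i <;> rfl
  rw [ha, hb]
  exact h _ _

theorem edge_map_iff {M M' : Type*} [Language.graph.Structure M] [Language.graph.Structure M']
    (f : M ≃[Language.graph] M') (x y : M) : Edge (f x) (f y) ↔ Edge x y := by
  rw [Edge, Edge, ← f.map_rel]
  exact iff_of_eq (congrArg _ (by ext i; fin_cases i <;> rfl))

theorem UniformlyDefinable.edge {ι : Type*} {G : ι → Type*} [∀ i, Language.graph.Structure (G i)]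
    {α : Type} (x y : α) :
    UniformlyDefinable Language.graph G fun i (a : α → G i) => Edge (a x) (a y) :=
  ⟨adj.formula₂ (Term.var x) (Term.var y), fun _ _ => by
    rw [Formula.realize_rel₂]; rfl⟩

/-- The tuple `y` of `M` is the image of the tuple `a` of `A` under an isomorphism. -/
def IsCopy {A M : Type*} [Language.graph.Structure A] [Language.graph.Structure M] {n : ℕ}
    (a : Fin n → A) (y : Fin n → M) : Prop :=
  ∃ f : A ≃[Language.graph] M, f ∘ a = y

theorem isCopy_iff {A M : Type*} [Language.graph.Structure A] [Language.graph.Structure M] {n : ℕ}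
    (a : Fin n → A) (y : Fin n → M) :
    IsCopy a y ↔ ∃ x : A → M, (∀ p : A × A, (x p.1 = x p.2 → p.1 = p.2) ∧
      (Edge (x p.1) (x p.2) ↔ Edge p.1 p.2)) ∧ (∀ z, ∃ c, z = x c) ∧ ∀ s, x (a s) = y s := by
  constructor
  · rintro ⟨f, rfl⟩
    exact ⟨f, fun p => ⟨fun h => f.injective h, edge_map_iff f _ _⟩,
      fun z => ⟨f.symm z, (f.apply_symm_apply z).symm⟩, fun s => rfl⟩
  · rintro ⟨x, hx, hsurj, hxy⟩
    let e : A ≃ M := Equiv.ofBijective x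
      ⟨fun c d => (hx (c, d)).1, fun z => (hsurj z).imp fun _ h => h.symm⟩
    exact ⟨⟨e, fun f => isEmptyElim f, fun R v => relMap_comp_iff_of_edge_iff (b := id)
      (fun i j => (hx (i, j)).2) R v⟩, funext hxy⟩

theorem UniformlyDefinable.isCopy {ι : Type*} {G : ι → Type*}
    [∀ i, Language.graph.Structure (G i)] {A : Type} [Finite A] [Language.graph.Structure A]
    {n : ℕ} (a : Fin n → A) : UniformlyDefinable Language.graph G fun _ y => IsCopy a y := by
  simp only [isCopy_iff]
  exact .exists_tuple <| .and (.forall_index fun p => .and (.imp (.eq _ _) (.const _))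
    (.iff (.edge _ _) (.const _))) <|
    .and (.forall_elem <| .exists_index fun c => .eq _ _) (.forall_index fun s => .eq _ _)

theorem UniformlyDefinable.of_eventually (G : ℕ → FinDigraph) {n : ℕ}
    {R : ∀ i, (Fin n → (G i).carrier) → Prop}
    (hR : ∀ i j (f : (G i).carrier ≃[Language.graph] (G j).carrier) a, R i a ↔ R j (f ∘ a))
    (N : ℕ) (h : UniformlyDefinable Language.graph (fun i : {i // N ≤ i} => (G i).carrier)
      fun i => R i) :
    UniformlyDefinable Language.graph (fun i => (G i).carrier) R := by
  obtain ⟨ψ, hψ⟩ := h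
  have exceptional : UniformlyDefinable Language.graph (fun i => (G i).carrier) fun _ y =>
      ∃ j : Fin N, ∃ a : Fin n → (G j).carrier, IsCopy a y :=
    .exists_index fun j => .exists_index fun a => .isCopy a
  have satisfied : UniformlyDefinable Language.graph (fun i => (G i).carrier) fun _ y =>
      ∃ j : Fin N, ∃ a : Fin n → (G j).carrier, R j a ∧ IsCopy a y :=
    .exists_index fun j => .exists_index fun a => .and (.const _) (.isCopy a)
  refine (satisfied.or (exceptional.not.and ⟨ψ, fun _ _ => Iff.rfl⟩)).congr fun i y => ?_
  by_cases hy : ∃ j : Fin N, ∃ a : Fin n → (G j).carrier, IsCopy a y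
  · simp only [hy, not_true_eq_false, false_and, or_false]
    constructor
    · intro hiy
      obtain ⟨j, a, f, rfl⟩ := hy
      exact ⟨j, a, (hR _ _ f a).2 hiy, f, rfl⟩
    · rintro ⟨j, a, ha, f, rfl⟩
      exact (hR _ _ f a).1 ha
  · have hi : N ≤ i := not_lt.1 fun hi => hy ⟨⟨i, hi⟩, y, .refl _ _, rfl⟩
    have hsat : ¬ ∃ j : Fin N, ∃ a : Fin n → (G j).carrier, R j a ∧ IsCopy a y :=
      fun ⟨j, a, _, ha⟩ => hy ⟨j, a, ha⟩
    simp only [hy, hsat, not_false_eq_true, true_and, false_or]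
    exact hψ ⟨i, hi⟩ y

end Digraphs

section Universality

/-- A binary relation `ω` on a set of points that is divided into the classes `{l} × β`: every way
to relate a new point to at most `k` given points is realized in every class. -/
def IsUniversal {Λ β : Type*} (k : ℕ) (ω : Λ × β → Λ × β → Bool) : Prop :=
  ∀ S : Finset (Λ × β), S.card ≤ k → ∀ (p q : Λ × β → Bool) (l : Λ),
    ∃ b, (l, b) ∉ S ∧ ∀ x ∈ S, ω (l, b) x = p x ∧ ω x (l, b) = q x

/-- Splits a Boolean function on `X` into its values at the points `c b i` and the rest. -/
noncomputable def arrowBoolEquiv {X B C : Type*} (c : B × C → X) (hc : Function.Injective c) :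
    (X → Bool) ≃ (B → C → Bool) × ({x // x ∉ Set.range c} → Bool) := by
  classical
  exact (Equiv.arrowCongr ((Equiv.sumCongr (Equiv.ofInjective c hc) (Equiv.refl _)).trans
      (Equiv.sumCompl fun x => x ∈ Set.range c)).symm (Equiv.refl Bool)).trans
    ((Equiv.sumArrowEquivProdArrow _ _ _).trans ((Equiv.curry _ _ _).prodCongr (Equiv.refl _)))

theorem card_forall_ne {X B C : Type*} [Finite X] [Finite B] [Finite C] (c : B × C → X)
    (hc : Function.Injective c) (t : C → Bool) :
    (Nat.card {f : X → Bool // ∀ b, (fun i => f (c (b, i))) ≠ t} : ℝ) =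
      Nat.card (X → Bool) * (1 - (2 ^ Nat.card C)⁻¹) ^ Nat.card B := by
  classical
  let e₁ : {f : X → Bool // ∀ b, (fun i => f (c (b, i))) ≠ t} ≃
      {g : (B → C → Bool) × ({x // x ∉ Set.range c} → Bool) // ∀ b, g.1 b ≠ t} :=
    (arrowBoolEquiv c hc).subtypeEquiv fun _ => Iff.rfl
  let e₂ : {g : (B → C → Bool) × ({x // x ∉ Set.range c} → Bool) // ∀ b, g.1 b ≠ t} ≃
      (B → {g : C → Bool // g ≠ t}) × ({x // x ∉ Set.range c} → Bool) :=
    (Equiv.prodSubtypeFstEquivSubtypeProd (p := fun g : B → C → Bool => ∀ b, g b ≠ t)).trans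
      ((Equiv.subtypePiEquivPi (p := fun _ g => g ≠ t)).prodCongr (Equiv.refl _))
  have hne : (Nat.card {g : C → Bool // g ≠ t} : ℝ) = 2 ^ Nat.card C - 1 := by
    have := Fintype.ofFinite C
    rw [Nat.card_eq_fintype_card, Fintype.card_subtype_compl, Nat.cast_sub]
    · simp
    · simpa using Nat.one_le_two_pow
  have h2 : (2 : ℝ) ^ Nat.card C * (1 - (2 ^ Nat.card C)⁻¹) = 2 ^ Nat.card C - 1 := by
    field_simp
  rw [Nat.card_congr e₁, Nat.card_congr e₂, Nat.card_prod, Nat.card_congr (arrowBoolEquiv c hc),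
    Nat.card_prod, Nat.card_fun, Nat.card_fun (α := B), Nat.card_fun (α := C)]
  push_cast
  rw [hne, ← h2, mul_pow, Nat.card_eq_fintype_card (α := Bool), Fintype.card_bool]
  push_cast
  ring

variable {Λ β : Type*} {k : ℕ}

/-- The pairs of the point `x` with the points `s`, in both directions. -/
def pairsWith {V : Type*} (s : Fin k → V) (x : V) : Fin k ⊕ Fin k → V × V :=
  Sum.elim (fun j => (x, s j)) fun j => (s j, x)

theorem injective_pairsWith {V B : Type*} {s : Fin k → V} (hs : Function.Injective s) {f : B → V}
    (hf : Function.Injective f) (hfs : ∀ b, f b ∉ Set.range s) :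
    Function.Injective fun x : B × (Fin k ⊕ Fin k) => pairsWith s (f x.1) x.2 := by
  rintro ⟨b, j | j⟩ ⟨b', j' | j'⟩ h <;> obtain ⟨h₁, h₂⟩ := Prod.ext_iff.1 h
  · exact congrArg₂ (fun b j => (b, Sum.inl j)) (hf h₁) (hs h₂)
  · exact (hfs b ⟨j', h₁.symm⟩).elim
  · exact (hfs b' ⟨j, h₁⟩).elim
  · exact congrArg₂ (fun b j => (b, Sum.inr j)) (hf h₂) (hs h₁)

theorem card_sub_le_card_notMem_range [Finite β] (s : Fin k → Λ × β) (l : Λ) :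
    Nat.card β - k ≤ Nat.card {b : β // (l, b) ∉ Set.range s} := by
  classical
  have hsplit : Nat.card β =
      Nat.card {b // (l, b) ∈ Set.range s} + Nat.card {b // (l, b) ∉ Set.range s} := by
    rw [← Nat.card_sum, Nat.card_congr (Equiv.sumCompl fun b => (l, b) ∈ Set.range s)]
  have hle : Nat.card {b // (l, b) ∈ Set.range s} ≤ k := by
    calc Nat.card {b // (l, b) ∈ Set.range s} ≤ Nat.card (Set.range s) :=
          Nat.card_le_card_of_injective (fun b => ⟨(l, b.1), b.2⟩) fun b b' h => by
            simpa [Subtype.ext_iff] using h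
      _ ≤ k := by simpa using Finite.card_range_le s
  omega

theorem card_pattern_omitted_le [Finite Λ] [Finite β] {s : Fin k → Λ × β}
    (hs : Function.Injective s) (t : Fin k ⊕ Fin k → Bool) (l : Λ) :
    (Nat.card {ω : (Λ × β) × (Λ × β) → Bool //
        ∀ b, (l, b) ∉ Set.range s → ω ∘ pairsWith s (l, b) ≠ t} : ℝ) ≤
      Nat.card ((Λ × β) × (Λ × β) → Bool) * (1 - (4 ^ k)⁻¹) ^ (Nat.card β - k) := by
  have hcount := card_forall_ne (fun x : {b : β // (l, b) ∉ Set.range s} × (Fin k ⊕ Fin k) =>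
    pairsWith s (l, x.1.1) x.2) (injective_pairsWith hs
      ((Prod.mk_right_injective l).comp Subtype.val_injective) fun b => b.2) t
  have h4 : (2 : ℝ) ^ Nat.card (Fin k ⊕ Fin k) = 4 ^ k := by
    simp [← two_mul, pow_mul]; norm_num
  rw [h4] at hcount
  simp only [Subtype.forall] at hcount
  refine hcount.trans_le (mul_le_mul_of_nonneg_left ?_ (Nat.cast_nonneg _))
  have hle : ((4 : ℝ) ^ k)⁻¹ ≤ 1 := inv_le_one_of_one_le₀ (one_le_pow₀ (by norm_num))
  have hpos : (0 : ℝ) < (4 ^ k)⁻¹ := by positivity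
  exact pow_le_pow_of_le_one (by linarith) (by linarith) (card_sub_le_card_notMem_range s l)

theorem exists_forall_of_card_not_le {I Ω : Type*} [Finite I] [Finite Ω] [Nonempty Ω]
    {P : I → Ω → Prop} {r : ℝ} (h : ∀ i, (Nat.card {ω // ¬ P i ω} : ℝ) ≤ Nat.card Ω * r)
    (hr : Nat.card I * r < 1) : ∃ ω, ∀ i, P i ω := by
  classical
  have := Fintype.ofFinite I
  have := Fintype.ofFinite Ω
  by_contra! hnot
  have hcover : Finset.univ = Finset.univ.biUnion fun i => {ω | ¬ P i ω} := by
    ext ω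
    simpa using hnot ω
  have hΩ : (0 : ℝ) < Nat.card Ω := Nat.cast_pos.2 Nat.card_pos
  refine lt_irrefl (Nat.card Ω : ℝ) ?_
  calc (Nat.card Ω : ℝ) = ((Finset.univ.biUnion fun i => {ω | ¬ P i ω}).card : ℝ) := by
        rw [← hcover, Finset.card_univ, Nat.card_eq_fintype_card]
    _ ≤ ∑ i, (({ω | ¬ P i ω} : Finset Ω).card : ℝ) := by exact_mod_cast Finset.card_biUnion_le
    _ ≤ ∑ _i : I, Nat.card Ω * r := Finset.sum_le_sum fun i _ => by
        simpa only [Nat.card_eq_fintype_card, Fintype.card_subtype] using h i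
    _ = Nat.card Ω * (Nat.card I * r) := by
        rw [Finset.sum_const, Finset.card_univ, nsmul_eq_mul, Nat.card_eq_fintype_card (α := I)]
        ring
    _ < Nat.card Ω := mul_lt_of_lt_one_right hΩ hr

theorem exists_forall_pattern [Finite Λ] [Finite β]
    (h : ((Nat.card Λ * Nat.card β : ℝ) ^ k * 4 ^ k * Nat.card Λ) *
      (1 - (4 ^ k)⁻¹) ^ (Nat.card β - k) < 1) :
    ∃ ω : (Λ × β) × (Λ × β) → Bool, ∀ s : Fin k → Λ × β, Function.Injective s →
      ∀ (t : Fin k ⊕ Fin k → Bool) (l : Λ),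
        ∃ b, (l, b) ∉ Set.range s ∧ ω ∘ pairsWith s (l, b) = t := by
  have hcard : (Nat.card ((Fin k ↪ Λ × β) × (Fin k ⊕ Fin k → Bool) × Λ) : ℝ) ≤
      (Nat.card Λ * Nat.card β) ^ k * 4 ^ k * Nat.card Λ := by
    have := Fintype.ofFinite Λ
    have := Fintype.ofFinite β
    have h4 : 2 ^ (k + k) = 4 ^ k := by rw [← two_mul, pow_mul]; norm_num
    have hle := Nat.descFactorial_le_pow (Fintype.card (Λ × β)) k
    rw [Fintype.card_prod] at hle
    simp only [Nat.card_eq_fintype_card, Fintype.card_prod, Fintype.card_embedding_eq,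
      Fintype.card_fin, Fintype.card_fun, Fintype.card_sum, Fintype.card_bool, h4, mul_assoc]
    exact_mod_cast Nat.mul_le_mul_right _ hle
  have hratio : (0 : ℝ) ≤ (1 - (4 ^ k)⁻¹) ^ (Nat.card β - k) :=
    pow_nonneg (sub_nonneg.2 (inv_le_one_of_one_le₀ (one_le_pow₀ (by norm_num)))) _
  obtain ⟨ω, hω⟩ := exists_forall_of_card_not_le
    (I := (Fin k ↪ Λ × β) × (Fin k ⊕ Fin k → Bool) × Λ)
    (P := fun i ω => ∃ b, (i.2.2, b) ∉ Set.range i.1 ∧ ω ∘ pairsWith i.1 (i.2.2, b) = i.2.1)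
    (fun i => by
      simpa only [not_exists, not_and] using card_pattern_omitted_le i.1.injective i.2.1 i.2.2)
    ((mul_le_mul_of_nonneg_right hcard hratio).trans_lt h)
  exact ⟨ω, fun s hs t l => hω (⟨s, hs⟩, t, l)⟩

theorem IsUniversal.of_forall_pattern [Finite Λ] [Finite β] (hβ : k ≤ Nat.card β)
    {ω : (Λ × β) × (Λ × β) → Bool}
    (h : ∀ s : Fin k → Λ × β, Function.Injective s → ∀ (t : Fin k ⊕ Fin k → Bool) (l : Λ),
      ∃ b, (l, b) ∉ Set.range s ∧ ω ∘ pairsWith s (l, b) = t) :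
    IsUniversal k fun x y => ω (x, y) := by
  intro S hS p q l
  have := Fintype.ofFinite Λ
  have := Fintype.ofFinite β
  have hk : k ≤ Fintype.card (Λ × β) := by
    rw [Fintype.card_prod, ← Nat.card_eq_fintype_card (α := β)]
    exact hβ.trans (Nat.le_mul_of_pos_left _ (Fintype.card_pos_iff.2 ⟨l⟩))
  obtain ⟨T, hST, hT⟩ := Finset.exists_superset_card_eq hS hk
  let s := T.equivFinOfCardEq hT
  obtain ⟨b, hb, ht⟩ := h (fun j => s.symm j) (Subtype.val_injective.comp s.symm.injective)
    (Sum.elim (fun j => p (s.symm j)) fun j => q (s.symm j)) l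
  refine ⟨b, fun hbS => hb ⟨s ⟨_, hST hbS⟩, by simp⟩, fun x hx => ?_⟩
  have hpair := fun i => congrFun ht i
  exact ⟨by simpa [pairsWith] using hpair (.inl (s ⟨x, hST hx⟩)),
    by simpa [pairsWith] using hpair (.inr (s ⟨x, hST hx⟩))⟩

theorem tendsto_mul_pow_mul_pow_sub (a : ℝ) (k : ℕ) {r : ℝ} (hr : 0 ≤ r) (hr' : r < 1) :
    Filter.Tendsto (fun n : ℕ => a * ((n + k : ℕ) : ℝ) ^ k * r ^ n) Filter.atTop (nhds 0) := by
  have hlim := (tendsto_pow_const_mul_const_pow_of_lt_one k hr hr').const_mul (|a| * (1 + k) ^ k)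
  rw [mul_zero] at hlim
  refine squeeze_zero_norm' ?_ hlim
  filter_upwards [Filter.eventually_ge_atTop 1] with n hn
  have hn : (1 : ℝ) ≤ n := by exact_mod_cast hn
  have hle : ((n + k : ℕ) : ℝ) ≤ (1 + k) * n := by push_cast; nlinarith [k.cast_nonneg (α := ℝ)]
  calc ‖a * ((n + k : ℕ) : ℝ) ^ k * r ^ n‖ = |a| * ((n + k : ℕ) : ℝ) ^ k * r ^ n := by
        rw [Real.norm_eq_abs, abs_mul, abs_mul, abs_pow, abs_pow, Nat.abs_cast, abs_of_nonneg hr]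
    _ ≤ |a| * ((1 + k) * n) ^ k * r ^ n := by gcongr
    _ = |a| * (1 + k) ^ k * (n ^ k * r ^ n) := by rw [mul_pow]; ring

theorem exists_isUniversal (Λ : Type*) [Finite Λ] (k : ℕ) :
    ∃ (B : ℕ) (ω : Λ × Fin B → Λ × Fin B → Bool), IsUniversal k ω := by
  have hle : ((4 : ℝ) ^ k)⁻¹ ≤ 1 := inv_le_one_of_one_le₀ (one_le_pow₀ (by norm_num))
  have hpos : (0 : ℝ) < (4 ^ k)⁻¹ := by positivity
  have hlim := tendsto_mul_pow_mul_pow_sub (Nat.card Λ ^ k * 4 ^ k * Nat.card Λ) k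
    (sub_nonneg.2 hle) (sub_lt_self 1 hpos)
  obtain ⟨n, hn⟩ := (hlim.eventually_lt_const one_pos).exists
  have hsmall : ((Nat.card Λ * Nat.card (Fin (n + k)) : ℝ) ^ k * 4 ^ k * Nat.card Λ) *
      (1 - (4 ^ k)⁻¹) ^ (Nat.card (Fin (n + k)) - k) < 1 := by
    rw [Nat.card_fin, Nat.add_sub_cancel, mul_pow]
    linarith
  obtain ⟨ω, hω⟩ := exists_forall_pattern hsmall
  exact ⟨n + k, _, .of_forall_pattern (by simp) hω⟩

theorem IsUniversal.exists_pairwise {I : Type*} [Finite I] {ω : Λ × β → Λ × β → Bool}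
    (hω : IsUniversal k ω) (hk : Nat.card I ≤ k) (l : I → Λ) (q : I) (z : β) :
    ∃ b : I → β, b q = z ∧ Pairwise fun p p' => ω (l p, b p) (l p', b p') = true := by
  classical
  have := Fintype.ofFinite I
  suffices h : ∀ A : Finset I, ∃ b : I → β, b q = z ∧
      (insert q A : Set I).Pairwise fun p p' => ω (l p, b p) (l p', b p') = true by
    obtain ⟨b, hb, h⟩ := h Finset.univ
    exact ⟨b, hb, by simpa [Set.pairwise_univ] using h⟩
  intro A
  induction A using Finset.induction_on with
  | empty => exact ⟨fun _ => z, rfl, by simp⟩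
  | insert r A _ ih =>
    obtain ⟨b, hb, h⟩ := ih
    rw [Finset.coe_insert, Set.insert_comm]
    by_cases hr : r ∈ (insert q A : Set I)
    · exact ⟨b, hb, by rwa [Set.insert_eq_of_mem hr]⟩
    obtain ⟨w, -, hw⟩ := hω ((insert q A).image fun p => (l p, b p))
      (Finset.card_image_le.trans ((Finset.card_le_univ _).trans
        (Nat.card_eq_fintype_card (α := I) ▸ hk))) (fun _ => true) (fun _ => true) (l r)
    have update_eq {p : I} (hp : p ∈ (insert q A : Set I)) : Function.update b r w p = b p :=
      Function.update_of_ne (by rintro rfl; exact hr hp) _ _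
    refine ⟨Function.update b r w, (update_eq (Set.mem_insert q _)).trans hb,
      Set.pairwise_insert.2 ⟨fun p hp p' hp' hne => ?_, fun p hp _ => ?_⟩⟩
    · simp only [update_eq hp, update_eq hp']
      exact h hp hp' hne
    · simp only [update_eq hp, Function.update_self]
      exact hw _ (Finset.mem_image_of_mem _ (by simpa using hp))

end Universality

section Models

/-- The label of a vertex: the part to which it belongs, the tuple of colours that it helps to
record (if any; the vertex is called special then), an index, and its colour. -/
structure Label (N S : ℕ) where
  part : Fin (N + 1)
  tuple : Option (Fin S → Fin (N + 1))
  idx : Fin S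
  col : Fin (N + 1)

instance (N S : ℕ) : Finite (Label N S) :=
  Finite.of_injective (fun l : Label N S => (l.part, l.tuple, l.idx, l.col)) fun l l' h => by
    cases l
    cases l'
    simpa using h

/-- For each part, the set of tuples of colours that it records. -/
abbrev Record (N S : ℕ) : Type := ℕ → (Fin S → Fin (N + 1)) → Prop

variable {N S : ℕ}

namespace Label

variable (T : ℕ → ℕ)

/-- The labels that are used: ordinary labels of part `j` have an index less than `T j`, and there
are special labels with indices less than `2 * T j` for the recorded tuples. -/
def Valid (R : Record N S) (l : Label N S) : Prop :=
  match l.tuple with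
  | none => l.idx.1 < T l.part
  | some u => l.idx.1 < 2 * T l.part ∧ R l.part u ∧ l.col = u l.idx

/-- Whether edges from vertices with label `l` to vertices with label `l'` are possible. Special
labels for the same tuple are linked in the order of their indices; an ordinary label is linked to
the labels of its part with another index modulo `T j`, so that it fits into no tournament of
special vertices with all the `2 * T j` indices. -/
def Linked (l l' : Label N S) : Prop :=
  l.part = l'.part ∧
    if l.tuple = none ∨ l'.tuple = none then l.idx.1 % T l.part ≠ l'.idx.1 % T l.part
    else l.tuple = l'.tuple ∧ l.idx < l'.idx

/-- The label with index `p` for the tuple `u` in part `j`. -/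
def special (j : Fin (N + 1)) (u : Fin S → Fin (N + 1)) (p : Fin S) : Label N S :=
  ⟨j, some u, p, u p⟩

variable {T}

theorem linked_iff_of_none {l l' : Label N S} (h : l.tuple = none ∨ l'.tuple = none) :
    l.Linked T l' ↔ l.part = l'.part ∧ l.idx.1 % T l.part ≠ l'.idx.1 % T l.part := by
  rw [Linked, if_pos h]

theorem linked_iff_of_ne_none {l l' : Label N S} (h : l.tuple ≠ none) (h' : l'.tuple ≠ none) :
    l.Linked T l' ↔ l.part = l'.part ∧ l.tuple = l'.tuple ∧ l.idx < l'.idx := by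
  rw [Linked, if_neg (not_or.2 ⟨h, h'⟩)]

theorem Linked.idx_ne {l l' : Label N S} (h : l.Linked T l') : l.idx ≠ l'.idx := by
  obtain ⟨-, h⟩ := h
  intro hidx
  split_ifs at h
  · exact h (by rw [hidx])
  · exact h.2.ne hidx

theorem not_linked_self (l : Label N S) : ¬ l.Linked T l := fun h => h.idx_ne rfl

theorem linked_special {j : Fin (N + 1)} {u : Fin S → Fin (N + 1)} {p q : Fin S} (h : p < q) :
    (special j u p).Linked T (special j u q) :=
  (linked_iff_of_ne_none (Option.some_ne_none u) (Option.some_ne_none u)).2 ⟨rfl, rfl, h⟩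

theorem valid_special {R : Record N S} {j : Fin (N + 1)} {u : Fin S → Fin (N + 1)} {p : Fin S}
    (hp : p.1 < 2 * T j) (hu : R j u) : (special j u p).Valid T R :=
  ⟨hp, hu, rfl⟩

variable {R : Record N S} {l : Label N S}

theorem Valid.idx_lt_of_none (hl : l.Valid T R) (h : l.tuple = none) : l.idx.1 < T l.part := by
  rwa [Valid, h] at hl

theorem Valid.of_some (hl : l.Valid T R) {u : Fin S → Fin (N + 1)} (hu : l.tuple = some u) :
    l.idx.1 < 2 * T l.part ∧ R l.part u ∧ l.col = u l.idx := by
  rwa [Valid, hu] at hl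

theorem Valid.idx_lt (hl : l.Valid T R) : l.idx.1 < 2 * T l.part := by
  cases hu : l.tuple with
  | none => exact (hl.idx_lt_of_none hu).trans_le (Nat.le_mul_of_pos_left _ two_pos)
  | some u => exact (hl.of_some hu).1

theorem Valid.eq_special (hl : l.Valid T R) {u : Fin S → Fin (N + 1)} (hu : l.tuple = some u) :
    l = special l.part u l.idx := by
  rw [special, ← hu, ← (hl.of_some hu).2.2]

theorem Valid.mono {R' : Record N S} (hl : l.Valid T R) (hR : ∀ u, R l.part u → R' l.part u) :
    l.Valid T R' := by
  rw [Valid] at hl ⊢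
  split
  next h => rwa [h] at hl
  next u h =>
    rw [h] at hl
    exact ⟨hl.1, hR u hl.2.1, hl.2.2⟩

end Label

/-- The digraph that consists of a chain of colours and of `B` vertices with each valid label, the
colour of a vertex being its only neighbour in the chain. The edges between vertices are given by
the relation `ω`, so far as their labels admit them. -/
inductive Model (T : ℕ → ℕ) (R : Record N S) {B : ℕ}
    (ω : Label N S × Fin B → Label N S × Fin B → Bool) : Type
  | chain (c : Fin (N + 1)) : Model T R ω
  | vert (l : Label N S) (h : l.Valid T R) (b : Fin B) : Model T R ω

namespace Model

variable {T : ℕ → ℕ} {R R' : Record N S} {B : ℕ}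
  {ω : Label N S × Fin B → Label N S × Fin B → Bool}

instance : Finite (Model T R ω) :=
  Finite.of_injective
    (fun x : Model T R ω => match x with
      | chain c => (Sum.inl c : Fin (N + 1) ⊕ Label N S × Fin B)
      | vert l _ b => Sum.inr (l, b)) fun x y h => by
    cases x <;> cases y <;> simp_all

instance : Nonempty (Model T R ω) := ⟨chain 0⟩

/-- The edges of the model. -/
def EdgeRel : Model T R ω → Model T R ω → Prop
  | chain c, chain c' => c ≤ c'
  | chain _, vert _ _ _ => False
  | vert l _ _, chain c => l.col = c
  | vert l _ b, vert l' _ b' => l.Linked T l' ∧ ω (l, b) (l', b') = true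

instance : Language.graph.Structure (Model T R ω) where
  RelMap | .adj => fun x => EdgeRel (x 0) (x 1)

@[simp]
theorem edge_chain_chain (c c' : Fin (N + 1)) :
    Edge (chain c : Model T R ω) (chain c') ↔ c ≤ c' := Iff.rfl

@[simp]
theorem not_edge_chain_vert (c : Fin (N + 1)) (l : Label N S) (h : l.Valid T R) (b : Fin B) :
    ¬ Edge (chain c : Model T R ω) (vert l h b) := id

@[simp]
theorem edge_vert_chain (c : Fin (N + 1)) (l : Label N S) (h : l.Valid T R) (b : Fin B) :
    Edge (vert l h b : Model T R ω) (chain c) ↔ l.col = c := Iff.rfl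

@[simp]
theorem edge_vert_vert (l l' : Label N S) (h : l.Valid T R) (h' : l'.Valid T R) (b b' : Fin B) :
    Edge (vert l h b : Model T R ω) (vert l' h' b') ↔
      l.Linked T l' ∧ ω (l, b) (l', b') = true := Iff.rfl

/-- The part of a vertex; the elements of the chain belong to no part. -/
def part : Model T R ω → Option ℕ
  | chain _ => none
  | vert l _ _ => some l.part

@[simp] theorem part_chain (c : Fin (N + 1)) : (chain c : Model T R ω).part = none := rfl

@[simp] theorem part_vert (l : Label N S) (h : l.Valid T R) (b : Fin B) :
    (vert l h b : Model T R ω).part = some l.part.1 := rfl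

theorem edge_self_iff (x : Model T R ω) : Edge x x ↔ x.part = none := by
  cases x <;> simp [Label.not_linked_self]

theorem edge_chain_self (c : Fin (N + 1)) : Edge (chain c : Model T R ω) (chain c) := le_refl c

theorem exists_eq_chain_of_edge_self {x : Model T R ω} (h : Edge x x) : ∃ c, x = chain c := by
  cases x with
  | chain c => exact ⟨c, rfl⟩
  | vert l hl b => exact absurd h.1 (Label.not_linked_self l)

theorem part_eq_of_edge {x y : Model T R ω} (h : Edge x y) (hy : y.part ≠ none) :
    x.part = y.part := by
  cases y with
  | chain c => simp at hy
  | vert l hl b =>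
    cases x with
    | chain c => simp at h
    | vert l' hl' b' => simp [((edge_vert_vert ..).1 h).1.1]

theorem exists_vert_of_part {x : Model T R ω} {j : ℕ} (h : x.part = some j) :
    ∃ l hl b, x = vert l hl b ∧ l.part.1 = j := by
  cases x with
  | chain c => simp at h
  | vert l hl b => exact ⟨l, hl, b, rfl, by simpa using h⟩

/-- What formulas with few variables see of an element: the parts from number `i` on look alike. -/
def view (i : ℕ) : Model T R ω → Fin (N + 1) ⊕ Label N S ⊕ Fin (N + 1)
  | chain c => .inl c
  | vert l _ _ => if l.part.1 < i then .inr (.inl l) else .inr (.inr l.col)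

@[simp] theorem view_chain (i : ℕ) (c : Fin (N + 1)) :
    (chain c : Model T R ω).view i = .inl c := rfl

theorem view_vert_of_lt {i : ℕ} {l : Label N S} (hl : l.part.1 < i) (h : l.Valid T R)
    (b : Fin B) : (vert l h b : Model T R ω).view i = .inr (.inl l) := if_pos hl

theorem view_vert_of_le {i : ℕ} {l : Label N S} (hl : i ≤ l.part.1) (h : l.Valid T R)
    (b : Fin B) : (vert l h b : Model T R ω).view i = .inr (.inr l.col) := if_neg hl.not_gt

theorem view_eq_inl_iff {i : ℕ} {x : Model T R ω} {c : Fin (N + 1)} :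
    x.view i = .inl c ↔ x = chain c := by
  cases x with
  | chain c' => simp
  | vert l hl b => rw [view]; split_ifs <;> simp

theorem eq_chain_iff_of_view {i : ℕ} {x : Model T R ω} {y : Model T R' ω}
    (h : x.view i = y.view i) (c : Fin (N + 1)) : x = chain c ↔ y = chain c := by
  rw [← view_eq_inl_iff (i := i), h, view_eq_inl_iff]

theorem exists_vert_of_view {i : ℕ} {l : Label N S} {hl : l.Valid T R} {b : Fin B}
    {y : Model T R' ω} (h : (vert l hl b : Model T R ω).view i = y.view i) :
    ∃ l' hl' b', y = vert l' hl' b' ∧ l'.col = l.col ∧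
      (l' = l ∨ i ≤ l.part.1 ∧ i ≤ l'.part.1) := by
  cases y with
  | chain c => cases view_eq_inl_iff.1 h
  | vert l' hl' b' =>
    refine ⟨l', hl', b', rfl, ?_⟩
    by_cases h₁ : l.part.1 < i <;> by_cases h₂ : l'.part.1 < i <;>
      simp only [view, h₁, h₂, if_true, if_false, Sum.inr.injEq, Sum.inl.injEq, reduceCtorEq] at h
    · exact ⟨congrArg _ h.symm, .inl h.symm⟩
    · exact ⟨h.symm, .inr ⟨not_lt.1 h₁, not_lt.1 h₂⟩⟩

theorem part_eq_none_iff_of_view {i : ℕ} {x : Model T R ω} {y : Model T R' ω}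
    (h : x.view i = y.view i) : x.part = none ↔ y.part = none := by
  cases x with
  | chain c => simp [(eq_chain_iff_of_view h c).1 rfl]
  | vert l hl b =>
    obtain ⟨l', hl', b', rfl, -⟩ := exists_vert_of_view h
    simp

theorem part_eq_some_iff_of_view {i j : ℕ} (hj : j < i) {x : Model T R ω} {y : Model T R' ω}
    (h : x.view i = y.view i) : x.part = some j ↔ y.part = some j := by
  cases x with
  | chain c => simp [(eq_chain_iff_of_view h c).1 rfl]
  | vert l hl b =>
    obtain ⟨l', hl', b', rfl, -, rfl | hle⟩ := exists_vert_of_view h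
    · simp
    · simp only [part_vert, Option.some_inj]
      omega

theorem edge_chain_iff_of_view {i : ℕ} {x : Model T R ω} {y : Model T R' ω}
    (h : x.view i = y.view i) (c : Fin (N + 1)) : Edge x (chain c) ↔ Edge y (chain c) := by
  cases x with
  | chain c' => simp [(eq_chain_iff_of_view h c').1 rfl]
  | vert l hl b =>
    obtain ⟨l', hl', b', rfl, hc, -⟩ := exists_vert_of_view h
    simp [hc]

theorem chain_edge_iff_of_view {i : ℕ} {x : Model T R ω} {y : Model T R' ω}
    (h : x.view i = y.view i) (c : Fin (N + 1)) :
    Edge (chain c : Model T R ω) x ↔ Edge (chain c : Model T R' ω) y := by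
  cases x with
  | chain c' => simp [(eq_chain_iff_of_view h c').1 rfl]
  | vert l hl b =>
    obtain ⟨l', hl', b', rfl, -, -⟩ := exists_vert_of_view h
    simp

/-- Positions that the pebble game with few pebbles does not distinguish, provided that the models
record the same in the parts before number `i`. -/
structure Alike (i : ℕ) {n : ℕ} (a : Fin n → Model T R ω) (b : Fin n → Model T R' ω) : Prop where
  view_eq : ∀ s, (a s).view i = (b s).view i
  eq_iff : ∀ s t, a s = a t ↔ b s = b t
  part_eq_iff : ∀ s t, (a s).part = (a t).part ↔ (b s).part = (b t).part
  edge_iff : ∀ s t, Edge (a s) (a t) ↔ Edge (b s) (b t)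

namespace Alike

variable {i m n k : ℕ} {a : Fin n → Model T R ω} {b : Fin n → Model T R' ω}

theorem symm (h : Alike i a b) : Alike i b a :=
  ⟨fun s => (h.view_eq s).symm, fun s t => (h.eq_iff s t).symm,
    fun s t => (h.part_eq_iff s t).symm, fun s t => (h.edge_iff s t).symm⟩

theorem reindex (h : Alike i a b) (f : Fin m → Fin n) : Alike i (a ∘ f) (b ∘ f) :=
  ⟨fun s => h.view_eq (f s), fun s t => h.eq_iff (f s) (f t),
    fun s t => h.part_eq_iff (f s) (f t), fun s t => h.edge_iff (f s) (f t)⟩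

theorem snoc (h : Alike i a b) {x : Model T R ω} {y : Model T R' ω} (hview : x.view i = y.view i)
    (heq : ∀ s, a s = x ↔ b s = y) (hpart : ∀ s, (a s).part = x.part ↔ (b s).part = y.part)
    (hout : ∀ s, Edge x (a s) ↔ Edge y (b s)) (hin : ∀ s, Edge (a s) x ↔ Edge (b s) y) :
    Alike i (Fin.snoc a x : Fin (n + 1) → Model T R ω)
      (Fin.snoc b y : Fin (n + 1) → Model T R' ω) where
  view_eq s := by
    cases s using Fin.lastCases <;> simp [hview, h.view_eq]
  eq_iff s t := by
    cases s using Fin.lastCases <;> cases t using Fin.lastCases <;>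
      simp [heq, h.eq_iff, eq_comm (a := x), eq_comm (a := y)]
  part_eq_iff s t := by
    cases s using Fin.lastCases <;> cases t using Fin.lastCases <;>
      simp [hpart, h.part_eq_iff, eq_comm (a := x.part), eq_comm (a := y.part)]
  edge_iff s t := by
    cases s using Fin.lastCases <;> cases t using Fin.lastCases <;>
      simp [hout, hin, h.edge_iff, edge_self_iff, part_eq_none_iff_of_view hview]

theorem snoc_apply (h : Alike i a b) (s : Fin n) :
    Alike i (Fin.snoc a (a s) : Fin (n + 1) → Model T R ω)
      (Fin.snoc b (b s) : Fin (n + 1) → Model T R' ω) :=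
  h.snoc (h.view_eq s) (h.eq_iff · s) (h.part_eq_iff · s) (h.edge_iff s) (h.edge_iff · s)

theorem snoc_chain (h : Alike i a b) (c : Fin (N + 1)) :
    Alike i (Fin.snoc a (chain c) : Fin (n + 1) → Model T R ω)
      (Fin.snoc b (chain c) : Fin (n + 1) → Model T R' ω) :=
  h.snoc rfl (fun s => eq_chain_iff_of_view (h.view_eq s) c)
    (fun s => part_eq_none_iff_of_view (h.view_eq s))
    (fun s => chain_edge_iff_of_view (h.view_eq s) c)
    fun s => edge_chain_iff_of_view (h.view_eq s) c

end Alike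

/-- The label and the number of a vertex. -/
def point : Model T R ω → Option (Label N S × Fin B)
  | chain _ => none
  | vert l _ b => some (l, b)

theorem exists_vert_edge_iff (hω : IsUniversal k ω) {n : ℕ} (hn : n ≤ k) (b : Fin n → Model T R ω)
    (p q : Model T R ω → Prop) {l : Label N S} (hl : l.Valid T R) :
    ∃ w, ∀ s, b s ≠ vert l hl w ∧ ∀ m hm z, b s = vert m hm z →
      (Edge (vert l hl w) (b s) ↔ l.Linked T m ∧ p (b s)) ∧
        (Edge (b s) (vert l hl w) ↔ m.Linked T l ∧ q (b s)) := by
  classical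
  let P : Finset (Label N S × Fin B) := Finset.univ.biUnion fun s => (b s).point.toFinset
  have hP : P.card ≤ k := (Finset.card_biUnion_le_card_mul _ _ 1 fun s _ => by
    rw [Option.card_toFinset]; cases (b s).point <;> simp).trans (by simpa using hn)
  have mem_P {s : Fin n} {m hm z} (hs : b s = vert m hm z) : (m, z) ∈ P :=
    Finset.mem_biUnion.2 ⟨s, Finset.mem_univ s, by simp [hs, point]⟩
  obtain ⟨w, hwP, hw⟩ := hω P hP (fun x => decide (∃ hm, p (vert x.1 hm x.2)))
    (fun x => decide (∃ hm, q (vert x.1 hm x.2))) l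
  refine ⟨w, fun s => ⟨fun hs => hwP (mem_P hs), fun m hm z hs => ?_⟩⟩
  simp only [hs, edge_vert_vert, hw _ (mem_P hs), decide_eq_true_eq]
  exact ⟨and_congr_right fun _ => exists_prop_of_true hm,
    and_congr_right fun _ => exists_prop_of_true hm⟩

namespace Alike

variable {i k n : ℕ} {a : Fin n → Model T R ω} {b : Fin n → Model T R' ω}

theorem exists_snoc_of_label (hω : IsUniversal k ω) (hn : n ≤ k) (h : Alike i a b)
    {l l' : Label N S} {hl : l.Valid T R} (hl' : l'.Valid T R') {z : Fin B}
    (hnew : ∀ s, a s ≠ vert l hl z)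
    (hview : ∀ w, (vert l hl z : Model T R ω).view i = (vert l' hl' w : Model T R' ω).view i)
    (hpart : ∀ s, (a s).part = some l.part.1 ↔ (b s).part = some l'.part.1)
    (hlink : ∀ s m hm w m' hm' w', a s = vert m hm w → b s = vert m' hm' w' →
      (l.Linked T m → l'.Linked T m') ∧ (m.Linked T l → m'.Linked T l')) :
    ∃ y, Alike i (Fin.snoc a (vert l hl z) : Fin (n + 1) → Model T R ω)
      (Fin.snoc b y : Fin (n + 1) → Model T R' ω) := by
  obtain ⟨w, hw⟩ := exists_vert_edge_iff hω hn b (fun y => ∃ s, b s = y ∧ Edge (vert l hl z) (a s))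
    (fun y => ∃ s, b s = y ∧ Edge (a s) (vert l hl z)) hl'
  have repeated {p : Model T R ω → Prop} (s : Fin n) : (∃ t, b t = b s ∧ p (a t)) ↔ p (a s) :=
    ⟨fun ⟨t, ht, hp⟩ => (h.eq_iff t s).2 ht ▸ hp, fun hp => ⟨s, rfl, hp⟩⟩
  have edges (s : Fin n) : (Edge (vert l hl z) (a s) ↔ Edge (vert l' hl' w) (b s)) ∧
      (Edge (a s) (vert l hl z) ↔ Edge (b s) (vert l' hl' w)) := by
    cases has : a s with
    | chain c =>
      rw [(eq_chain_iff_of_view (h.view_eq s) c).1 has]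
      exact ⟨edge_chain_iff_of_view (hview w) c, by simp⟩
    | vert m hm w₀ =>
      obtain ⟨m', hm', w', hbs, -⟩ := exists_vert_of_view (has ▸ h.view_eq s)
      obtain ⟨hout, hin⟩ := (hw s).2 m' hm' w' hbs
      rw [hout, hin, repeated, repeated (p := fun x => Edge x _), has]
      have hlink := hlink s _ _ _ _ _ _ has hbs
      exact ⟨(and_iff_right_of_imp fun he => hlink.1 he.1).symm,
        (and_iff_right_of_imp fun he => hlink.2 he.1).symm⟩
  exact ⟨vert l' hl' w, h.snoc (hview w) (fun s => iff_of_false (hnew s) (hw s).1) hpart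
    (fun s => (edges s).1) fun s => (edges s).2⟩

theorem exists_snoc_of_part_lt (hω : IsUniversal k ω) (hn : n ≤ k) (h : Alike i a b)
    {l : Label N S} (hl : l.Valid T R) (hl' : l.Valid T R') (z : Fin B) (hi : l.part.1 < i)
    (hnew : ∀ s, a s ≠ vert l hl z) :
    ∃ y, Alike i (Fin.snoc a (vert l hl z) : Fin (n + 1) → Model T R ω)
      (Fin.snoc b y : Fin (n + 1) → Model T R' ω) := by
  refine h.exists_snoc_of_label hω hn hl' hnew
    (fun w => by rw [view_vert_of_lt hi, view_vert_of_lt hi])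
    (fun s => part_eq_some_iff_of_view hi (h.view_eq s)) fun s m hm w m' hm' w' has hbs => ?_
  obtain ⟨_, _, _, hbs', -, rfl | hle⟩ := exists_vert_of_view (has ▸ h.view_eq s)
  · cases hbs.symm.trans hbs'
    exact ⟨id, id⟩
  · exact ⟨fun hlm => absurd (hlm.1 ▸ hi) hle.1.not_gt, fun hml => absurd (hml.1 ▸ hi) hle.1.not_gt⟩

theorem exists_part (h : Alike i a b) (hN : i + n ≤ N) {j : ℕ} (hj : i ≤ j) :
    ∃ j' : Fin (N + 1), i ≤ j'.1 ∧ ∀ s, (a s).part = some j ↔ (b s).part = some j'.1 := by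
  classical
  by_cases hs : ∃ s, (a s).part = some j
  · obtain ⟨s, hs⟩ := hs
    obtain ⟨m, hm, w, has, rfl⟩ := exists_vert_of_part hs
    obtain ⟨m', hm', w', hbs, -, hm'⟩ := exists_vert_of_view (has ▸ h.view_eq s)
    refine ⟨m'.part, hm'.elim (· ▸ hj) And.right, fun t => ?_⟩
    simpa only [has, hbs, part_vert] using h.part_eq_iff t s
  · obtain ⟨p, hp, hunused⟩ := Finset.exists_mem_notMem_of_card_lt_card
      (s := Finset.univ.image fun s => (b s).part) (t := (Finset.Icc i N).image some)
      (Finset.card_image_le.trans_lt (by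
        rw [Finset.card_image_of_injective _ (Option.some_injective _), Nat.card_Icc,
          Finset.card_univ, Fintype.card_fin]
        omega))
    obtain ⟨j', hj', rfl⟩ := Finset.mem_image.1 hp
    obtain ⟨hi, hN⟩ := Finset.mem_Icc.1 hj'
    exact ⟨⟨j', Nat.lt_succ_of_le hN⟩, hi, fun s => iff_of_false (fun has => hs ⟨s, has⟩)
      fun hbs => hunused (Finset.mem_image.2 ⟨s, Finset.mem_univ s, hbs⟩)⟩

end Alike

theorem exists_lt_forall_idx_mod_ne {n t : ℕ} (hnt : n < t) (b : Fin n → Model T R ω) :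
    ∃ r < t, ∀ s m hm w, b s = vert m hm w → m.idx.1 % t ≠ r := by
  classical
  let residue : Model T R ω → ℕ
    | chain _ => 0
    | vert m _ _ => m.idx.1 % t
  obtain ⟨r, hr, hunused⟩ := Finset.exists_mem_notMem_of_card_lt_card
    (s := Finset.univ.image fun s => residue (b s)) (t := Finset.range t)
    (Finset.card_image_le.trans_lt (by simpa using hnt))
  exact ⟨r, Finset.mem_range.1 hr, fun s m hm w hs hm' =>
    hunused (Finset.mem_image.2 ⟨s, Finset.mem_univ s, by rwa [hs]⟩)⟩

namespace Alike

variable {i k K n : ℕ} {a : Fin n → Model T R ω} {b : Fin n → Model T R' ω}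

theorem exists_snoc_of_le_part (hω : IsUniversal k ω) (hn : n ≤ k)
    (hT : ∀ j, i ≤ j → j ≤ N → n < T j ∧ T j ≤ S) (hN : i + n ≤ N) (h : Alike i a b)
    {l : Label N S} (hl : l.Valid T R) (z : Fin B) (hi : i ≤ l.part.1)
    (hnew : ∀ s, a s ≠ vert l hl z) :
    ∃ y, Alike i (Fin.snoc a (vert l hl z) : Fin (n + 1) → Model T R ω)
      (Fin.snoc b y : Fin (n + 1) → Model T R' ω) := by
  obtain ⟨j, hij, hj⟩ := h.exists_part hN hi
  obtain ⟨hnT, hTS⟩ := hT j hij (Nat.lt_succ_iff.1 j.2)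
  obtain ⟨r, hr, hmod⟩ := exists_lt_forall_idx_mod_ne hnT b
  let l' : Label N S := ⟨j, none, ⟨r, hr.trans_le hTS⟩, l.col⟩
  have hl' : l'.Valid T R' := hr
  refine h.exists_snoc_of_label hω hn hl' hnew
    (fun w => (view_vert_of_le hi hl z).trans (view_vert_of_le (l := l') hij hl' w).symm) hj
    fun s m hm w m' hm' w' has hbs => ?_
  have hne : m'.idx.1 % T j ≠ r % T j := by
    rw [Nat.mod_eq_of_lt hr]
    exact hmod s m' hm' w' hbs
  have hpart (hm : m.part = l.part) : m'.part = j :=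
    Fin.ext (by simpa [hbs] using (hj s).1 (by rw [has, part_vert, hm]))
  refine ⟨fun hlm => ?_, fun hml => ?_⟩
  · exact (Label.linked_iff_of_none (.inl rfl)).2 ⟨(hpart hlm.1.symm).symm, hne.symm⟩
  · exact (Label.linked_iff_of_none (.inr rfl)).2 ⟨hpart hml.1, by rwa [hpart hml.1]⟩

theorem exists_snoc (hω : IsUniversal k ω) (hK : K ≤ k) (hR : ∀ j < i, ∀ u, R j u → R' j u)
    (hT : ∀ j, i ≤ j → j ≤ N → K ≤ T j ∧ T j ≤ S) (hN : i + K ≤ N + 1) (hn : n + 1 ≤ K)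
    (h : Alike i a b) (x : Model T R ω) :
    ∃ y, Alike i (Fin.snoc a x : Fin (n + 1) → Model T R ω)
      (Fin.snoc b y : Fin (n + 1) → Model T R' ω) := by
  by_cases hold : ∃ s, a s = x
  · obtain ⟨s, rfl⟩ := hold
    exact ⟨b s, h.snoc_apply s⟩
  cases x with
  | chain c => exact ⟨chain c, h.snoc_chain c⟩
  | vert l hl z =>
    rcases lt_or_ge l.part.1 i with hi | hi
    · exact h.exists_snoc_of_part_lt hω (by omega) hl (hl.mono (hR _ hi)) z hi (not_exists.1 hold)
    · exact h.exists_snoc_of_le_part hω (by omega)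
        (fun j hij hj => ⟨hn.trans (hT j hij hj).1, (hT j hij hj).2⟩) (by omega) hl z hi
        (not_exists.1 hold)

end Alike

/-- Models with the same records in the parts before number `i` admit a pebble system. -/
def pebbleSystem {i K k : ℕ} (hω : IsUniversal k ω) (hK : K ≤ k)
    (hR : ∀ j < i, ∀ u, R j u ↔ R' j u) (hT : ∀ j, i ≤ j → j ≤ N → K ≤ T j ∧ T j ≤ S)
    (hN : i + K ≤ N + 1) : PebbleSystem Language.graph (Model T R ω) (Model T R' ω) K where
  rel a b := Alike i a b
  reindex h f := h.reindex f
  eq_iff h := h.eq_iff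
  relMap_iff h _ R f := relMap_comp_iff_of_edge_iff h.edge_iff R f
  forth hn h x := h.exists_snoc hω hK (fun j hj u => (hR j hj u).1) hT hN hn x
  back hn h y := by
    obtain ⟨x, hx⟩ := h.symm.exists_snoc hω hK (fun j hj u => (hR j hj u).2) hT hN hn y
    exact ⟨x, hx.symm⟩

end Model

end Models

section Tournaments

variable {M : Type*} [Language.graph.Structure M] {m n : ℕ}

/-- A transitive tournament, listed in its order. -/
structure IsTransitiveTournament (x : Fin m → M) : Prop where
  not_edge_self : ∀ p, ¬ Edge (x p) (x p)
  edge : ∀ p q, p < q → Edge (x p) (x q)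

theorem IsTransitiveTournament.comp_strictMono {x : Fin n → M} (h : IsTransitiveTournament x)
    {f : Fin m → Fin n} (hf : StrictMono f) : IsTransitiveTournament (x ∘ f) :=
  ⟨fun p => h.not_edge_self (f p), fun _ _ hpq => h.edge _ _ (hf hpq)⟩

/-- Vertices without a loop that have a common successor without a loop: in the models below, the
vertices that belong to the same part. -/
def SamePart (x y : M) : Prop :=
  ¬ Edge x x ∧ ¬ Edge y y ∧ ∃ z, ¬ Edge z z ∧ Edge x z ∧ Edge y z

/-- There is a transitive tournament with `m` vertices in the part of `v`. -/
def HasTournament (m : ℕ) (v : M) : Prop :=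
  ∃ x : Fin m → M, IsTransitiveTournament x ∧ ∀ p, SamePart (x p) v

theorem HasTournament.mono {v : M} (h : HasTournament n v) (hmn : m ≤ n) : HasTournament m v := by
  obtain ⟨x, hx, hv⟩ := h
  exact ⟨x ∘ Fin.castLE hmn, hx.comp_strictMono (Fin.strictMono_castLE hmn), fun p => hv _⟩

/-- The largest transitive tournaments in the part of `v` have `m` vertices. -/
def HasMaxTournament (m : ℕ) (v : M) : Prop := HasTournament m v ∧ ¬ HasTournament (m + 1) v

/-- The conditions on the parameters of a model under which its parts can be told apart by the
sizes of their largest transitive tournaments. -/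
structure Admissible {N S B : ℕ} (T : ℕ → ℕ) (R : Record N S)
    (ω : Label N S × Fin B → Label N S × Fin B → Bool) : Prop where
  universal : IsUniversal S ω
  three_le : ∀ j, 3 ≤ T j
  strictMono : StrictMono T
  le : 2 * T N ≤ S
  record_zero : ∀ j, R j fun _ => 0
  support : ∀ j u, R j u → ∀ p : Fin S, 2 * T j ≤ p.1 → u p = 0

theorem Admissible.two_mul_le {N S B : ℕ} {T : ℕ → ℕ} {R : Record N S}
    {ω : Label N S × Fin B → Label N S × Fin B → Bool} (hG : Admissible T R ω) (j : Fin (N + 1)) :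
    2 * T j ≤ S :=
  (Nat.mul_le_mul_left 2 (hG.strictMono.monotone (Nat.lt_succ_iff.1 j.2))).trans hG.le

namespace Label

variable {N S : ℕ} {T : ℕ → ℕ} {R : Record N S} {j : Fin (N + 1)} {l : Fin (2 * T j) → Label N S}

theorem exists_idx_eq_of_linked (hl : ∀ p, (l p).Valid T R) (hj : ∀ p, (l p).part = j)
    (hlink : ∀ p q, p < q → (l p).Linked T (l q)) {r : ℕ} (hr : r < 2 * T j) :
    ∃ p, (l p).idx.1 = r := by
  let f : Fin (2 * T j) → Fin (2 * T j) := fun p => ⟨(l p).idx, hj p ▸ (hl p).idx_lt⟩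
  have hinj : Function.Injective f := fun p q hpq => by
    have hidx : (l p).idx = (l q).idx := Fin.ext (Fin.mk.inj hpq)
    by_contra hne
    rcases lt_or_gt_of_ne hne with hlt | hlt
    · exact (hlink _ _ hlt).idx_ne hidx
    · exact (hlink _ _ hlt).idx_ne hidx.symm
  obtain ⟨p, hp⟩ := Finite.surjective_of_injective hinj ⟨r, hr⟩
  exact ⟨p, Fin.val_eq_of_eq hp⟩

theorem tuple_ne_none_of_linked (hl : ∀ p, (l p).Valid T R) (hj : ∀ p, (l p).part = j)
    (hlink : ∀ p q, p < q → (l p).Linked T (l q)) (p : Fin (2 * T j)) : (l p).tuple ≠ none := by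
  intro hnone
  have hlt : (l p).idx.1 < T j := hj p ▸ (hl p).idx_lt_of_none hnone
  obtain ⟨q, hq⟩ := exists_idx_eq_of_linked hl hj hlink (r := (l p).idx + T j) (by omega)
  have hmod : (l q).idx.1 % T j = (l p).idx.1 % T j := by rw [hq, Nat.add_mod_right]
  rcases lt_trichotomy p q with hpq | rfl | hpq
  · exact hj p ▸ ((linked_iff_of_none (.inl hnone)).1 (hlink _ _ hpq)).2 <| hj p ▸ hmod.symm
  · omega
  · exact hj q ▸ ((linked_iff_of_none (.inr hnone)).1 (hlink _ _ hpq)).2 <| hj q ▸ hmod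

theorem exists_eq_special_of_linked (hT : 0 < T j) (hS : 2 * T j ≤ S)
    (hl : ∀ p, (l p).Valid T R) (hj : ∀ p, (l p).part = j)
    (hlink : ∀ p q, p < q → (l p).Linked T (l q)) :
    ∃ u, R j u ∧ ∀ p, l p = special j u (Fin.castLE hS p) := by
  have hnone := tuple_ne_none_of_linked hl hj hlink
  have hlt {p q} (hpq : p < q) : (l p).tuple = (l q).tuple ∧ (l p).idx < (l q).idx :=
    ((linked_iff_of_ne_none (hnone p) (hnone q)).1 (hlink p q hpq)).2
  let f : Fin (2 * T j) → Fin (2 * T j) := fun p => ⟨(l p).idx, hj p ▸ (hl p).idx_lt⟩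
  have hf : StrictMono f := fun p q hpq => (hlt hpq).2
  have hfix (p) : f p = p := le_antisymm hf.apply_le hf.le_apply
  have hidx (p) : (l p).idx = Fin.castLE hS p := by simpa [f, Fin.ext_iff] using hfix p
  let o : Fin (2 * T j) := ⟨0, by omega⟩
  obtain ⟨u, hu⟩ := Option.ne_none_iff_exists'.1 (hnone o)
  have htuple (p) : (l p).tuple = some u := by
    rcases (show o ≤ p from Nat.zero_le p).eq_or_lt with rfl | hop
    · exact hu
    · rw [← (hlt hop).1, hu]
  exact ⟨u, hj o ▸ ((hl o).of_some (htuple o)).2.1, fun p => by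
    rw [(hl p).eq_special (htuple p), hj, hidx]⟩

end Label

section

variable {N S B : ℕ} {T : ℕ → ℕ} {R : Record N S}
  {ω : Label N S × Fin B → Label N S × Fin B → Bool}

theorem samePart_iff (hG : Admissible T R ω) (x y : Model T R ω) :
    SamePart x y ↔ x.part ≠ none ∧ x.part = y.part := by
  constructor
  · rintro ⟨hx, -, z, hz, hxz, hyz⟩
    rw [Model.edge_self_iff] at hx hz
    exact ⟨hx, (Model.part_eq_of_edge hxz hz).trans (Model.part_eq_of_edge hyz hz).symm⟩
  · rintro ⟨hx, hxy⟩
    refine ⟨by rwa [Model.edge_self_iff], by rwa [Model.edge_self_iff, ← hxy], ?_⟩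
    obtain ⟨j, hj⟩ := Option.ne_none_iff_exists'.1 hx
    obtain ⟨l, hl, b, rfl, rfl⟩ := Model.exists_vert_of_part hj
    obtain ⟨l', hl', b', rfl, hpart⟩ := Model.exists_vert_of_part (hxy.symm.trans hj)
    have h3 := hG.three_le l.part
    have hS := hG.two_mul_le l.part
    obtain ⟨r, hr, hmod⟩ := Model.exists_lt_forall_idx_mod_ne h3
      ![(.vert l hl b : Model T R ω), .vert l' hl' b']
    let m : Label N S := ⟨l.part, none, ⟨r, by omega⟩, 0⟩
    have linked {k : Label N S} (hk : k.part = l.part) (hr' : k.idx.1 % T l.part ≠ r) :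
        k.Linked T m :=
      (Label.linked_iff_of_none (.inr rfl)).2 ⟨hk, by rwa [hk, Nat.mod_eq_of_lt hr]⟩
    obtain ⟨w, hw⟩ := Model.exists_vert_edge_iff hG.universal (by omega)
      ![(.vert l hl b : Model T R ω), .vert l' hl' b'] (fun _ => True) (fun _ => True)
      (show m.Valid T R from hr)
    exact ⟨_, by simp [Model.edge_self_iff],
      ((hw 0).2 l hl b rfl).2.2 ⟨linked rfl (hmod 0 l hl b rfl), trivial⟩,
      ((hw 1).2 l' hl' b' rfl).2.2 ⟨linked (Fin.ext hpart) (hmod 1 l' hl' b' rfl), trivial⟩⟩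

theorem IsTransitiveTournament.part_eq {x : Fin m → Model T R ω} (h : IsTransitiveTournament x)
    (p q : Fin m) : (x p).part = (x q).part := by
  have hne (p) : (x p).part ≠ none := (Model.edge_self_iff _).not.1 (h.not_edge_self p)
  rcases lt_trichotomy p q with hpq | rfl | hpq
  · exact Model.part_eq_of_edge (h.edge _ _ hpq) (hne q)
  · rfl
  · exact (Model.part_eq_of_edge (h.edge _ _ hpq) (hne p)).symm

theorem IsTransitiveTournament.exists_eq_special (hG : Admissible T R ω) {j : Fin (N + 1)}
    {x : Fin (2 * T j) → Model T R ω} (h : IsTransitiveTournament x) {q : Fin (2 * T j)}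
    (hq : (x q).part = some j.1) :
    ∃ u, R j u ∧ ∀ p, ∃ hl b, x p =
      .vert (Label.special j u (Fin.castLE (hG.two_mul_le j) p)) hl b := by
  choose l hl b hx hpart using fun p =>
    Model.exists_vert_of_part ((h.part_eq p q).trans hq)
  have hlink (p q) (hpq : p < q) : (l p).Linked T (l q) := by
    have := h.edge p q hpq
    rw [hx p, hx q, Model.edge_vert_vert] at this
    exact this.1
  obtain ⟨u, hu, hlu⟩ := Label.exists_eq_special_of_linked ((hG.three_le j).trans_lt' three_pos)
    (hG.two_mul_le j) hl (fun p => Fin.ext (hpart p)) hlink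
  refine ⟨u, hu, fun p => ⟨hlu p ▸ hl p, b p, ?_⟩⟩
  rw [hx p]
  congr
  exact hlu p

theorem exists_isTransitiveTournament (hG : Admissible T R ω) {j : Fin (N + 1)}
    {u : Fin S → Fin (N + 1)} (hu : R j u) (q : Fin (2 * T j)) (z : Fin B) :
    ∃ b : Fin (2 * T j) → Fin B, b q = z ∧ IsTransitiveTournament fun p =>
      (.vert (Label.special j u (Fin.castLE (hG.two_mul_le j) p)) (Label.valid_special p.2 hu)
        (b p) : Model T R ω) := by
  obtain ⟨b, hb, h⟩ := hG.universal.exists_pairwise (by simpa using hG.two_mul_le j)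
    (fun p => Label.special j u (Fin.castLE (hG.two_mul_le j) p)) q z
  exact ⟨b, hb, fun p => by simp [Model.edge_self_iff],
    fun p p' hpp => ⟨Label.linked_special hpp, h hpp.ne⟩⟩

theorem not_hasTournament (hG : Admissible T R ω) {v : Model T R ω} {j : Fin (N + 1)}
    (hv : v.part = some j.1) : ¬ HasTournament (2 * T j + 1) v := by
  rintro ⟨x, hx, hxv⟩
  have h3 := hG.three_le j
  have hpart (p) : (x p).part = some j.1 := ((samePart_iff hG _ _).1 (hxv p)).2.trans hv
  obtain ⟨u, -, hu⟩ := (hx.comp_strictMono Fin.strictMono_castSucc).exists_eq_special hG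
    (q := ⟨0, by omega⟩) (hpart _)
  obtain ⟨u', -, hu'⟩ := (hx.comp_strictMono Fin.strictMono_succ).exists_eq_special hG
    (q := ⟨0, by omega⟩) (hpart _)
  -- The second vertex of the tournament would have both indices 1 and 0.
  obtain ⟨_, _, h₁⟩ := hu ⟨1, by omega⟩
  obtain ⟨_, _, h₀⟩ := hu' ⟨0, by omega⟩
  simpa [Label.special] using h₁.symm.trans h₀

theorem hasTournament (hG : Admissible T R ω) {v : Model T R ω} {j : Fin (N + 1)}
    (hv : v.part = some j.1) : HasTournament (2 * T j) v := by
  obtain ⟨l, -, z, -⟩ := Model.exists_vert_of_part hv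
  have h3 := hG.three_le j
  obtain ⟨b, -, hb⟩ := exists_isTransitiveTournament hG (hG.record_zero j) ⟨0, by omega⟩ z
  exact ⟨_, hb, fun p => (samePart_iff hG _ _).2 ⟨Option.some_ne_none _, hv.symm⟩⟩

theorem hasTournament_iff (hG : Admissible T R ω) {v : Model T R ω} {j : Fin (N + 1)}
    (hv : v.part = some j.1) (m : ℕ) : HasTournament m v ↔ m ≤ 2 * T j :=
  ⟨fun h => not_lt.1 fun hlt => not_hasTournament hG hv (h.mono hlt), (hasTournament hG hv).mono⟩

theorem hasMaxTournament_iff (hG : Admissible T R ω) (v : Model T R ω) (j : ℕ) :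
    HasMaxTournament (2 * T j) v ↔ v.part = some j := by
  cases hv : v.part with
  | none =>
    refine iff_of_false ?_ (by simp)
    rintro ⟨⟨x, -, hx⟩, -⟩
    have h3 := hG.three_le j
    obtain ⟨hne, heq⟩ := (samePart_iff hG _ _).1 (hx ⟨0, by omega⟩)
    exact hne (heq.trans hv)
  | some j' =>
    obtain ⟨l, hl, b, rfl, rfl⟩ := Model.exists_vert_of_part hv
    rw [HasMaxTournament, hasTournament_iff hG hv, hasTournament_iff hG hv, Option.some_inj,
      ← hG.strictMono.injective.eq_iff]
    omega

end

end Tournaments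

section Codes

/-- The positions of the code of an `n`-tuple: what the code tells about the entries of the tuple
with regard to the parts before number `i`, in which the records consist of `2 * t j` vertices.
The position `mark` tells codes from the trivial tuple. -/
inductive Position {i : ℕ} (t : Fin i → ℕ) (n : ℕ) : Type
  | mark
  | eq (s s' : Fin n)
  | samePart (s s' : Fin n)
  | edge (s s' : Fin n)
  | kind (s : Fin n) (j : Fin i) (special : Bool) (q : Fin (2 * t j))
  | col (s : Fin n)
  | entry (s : Fin n) (j : Fin i) (p : Fin (2 * t j))

instance {i : ℕ} (t : Fin i → ℕ) (n : ℕ) : Finite (Position t n) :=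
  Finite.of_injective
    (fun p : Position t n => match p with
      | .mark => (.inl () : Unit ⊕ (Fin 3 × Fin n × Fin n) ⊕
          (Fin n × Bool × (j : Fin i) × Fin (2 * t j)) ⊕ Fin n ⊕
          (Fin n × (j : Fin i) × Fin (2 * t j)))
      | .eq s s' => .inr (.inl (0, s, s'))
      | .samePart s s' => .inr (.inl (1, s, s'))
      | .edge s s' => .inr (.inl (2, s, s'))
      | .kind s j special q => .inr (.inr (.inl (s, special, ⟨j, q⟩)))
      | .col s => .inr (.inr (.inr (.inl s)))
      | .entry s j p => .inr (.inr (.inr (.inr (s, ⟨j, p⟩))))) fun p p' h => by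
    cases p <;> cases p' <;> simp_all

noncomputable instance {i : ℕ} (t : Fin i → ℕ) (n : ℕ) : Fintype (Position t n) :=
  Fintype.ofFinite _

/-- The colour that stands for the truth value of a proposition. -/
noncomputable def truthColour {N : ℕ} (P : Prop) : Fin (N + 1) :=
  open scoped Classical in if P then Fin.last N else 0

theorem truthColour_eq_iff {N : ℕ} (hN : 0 < N) {P Q : Prop} :
    (truthColour P : Fin (N + 1)) = truthColour Q ↔ (P ↔ Q) := by
  have : Fin.last N ≠ 0 := fun h => hN.ne' (congrArg Fin.val h)
  by_cases hP : P <;> by_cases hQ : Q <;> simp [truthColour, hP, hQ, this, this.symm]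

namespace Model

variable {N S B : ℕ} {T : ℕ → ℕ} {R R' : Record N S}
  {ω : Label N S × Fin B → Label N S × Fin B → Bool}

/-- The colour of an element. -/
def col : Model T R ω → Fin (N + 1)
  | chain c => c
  | vert l _ _ => l.col

/-- The part of a vertex, whether it is special, and its index. -/
def kind : Model T R ω → Option (ℕ × Bool × ℕ)
  | chain _ => none
  | vert l _ _ => some (l.part, l.tuple.isSome, l.idx)

/-- The entry number `p` of the tuple of a special vertex of part `j`. For the other elements this
is just their colour. -/
def entry (j p : ℕ) : Model T R ω → Fin (N + 1)
  | chain c => c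
  | vert l _ _ => match l.tuple with
    | none => l.col
    | some u => if h : l.part.1 = j ∧ p < S then u ⟨p, h.2⟩ else l.col

theorem entry_special {j p : ℕ} {l : Label N S} {u : Fin S → Fin (N + 1)} (hu : l.tuple = some u)
    (hj : l.part.1 = j) (hp : p < S) (hl : l.Valid T R) (b : Fin B) :
    (vert l hl b : Model T R ω).entry j p = u ⟨p, hp⟩ := by
  simp [entry, hu, hj, hp]

theorem entry_eq_col {j : ℕ} {x : Model T R ω} (hx : ∀ q, x.kind ≠ some (j, true, q)) (p : ℕ) :
    x.entry j p = x.col := by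
  cases x with
  | chain c => rfl
  | vert l hl b =>
    rw [entry, col]
    split
    · rfl
    next u hu => exact dif_neg fun h => hx l.idx (by simp [kind, hu, h.1])

/-- The value of the code of a tuple at a position. -/
noncomputable def value {i n : ℕ} (x : Fin n → Model T R ω) :
    Position (fun j : Fin i => T j) n → Fin (N + 1)
  | .mark => truthColour True
  | .eq s s' => truthColour (x s = x s')
  | .samePart s s' => truthColour ((x s).part = (x s').part)
  | .edge s s' => truthColour (Edge (x s) (x s'))
  | .kind s j special q => truthColour ((x s).kind = some (j.1, special, q.1))
  | .col s => (x s).col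
  | .entry s j p => (x s).entry j p

/-- The code of a tuple. -/
noncomputable def code (i : ℕ) {n : ℕ} (x : Fin n → Model T R ω) (p : Fin S) : Fin (N + 1) :=
  if h : p.1 < Fintype.card (Position (fun j : Fin i => T j) n) then
    value x ((Fintype.equivFin _).symm ⟨p, h⟩)
  else 0

theorem code_equivFin {i n : ℕ} (hS : Fintype.card (Position (fun j : Fin i => T j) n) ≤ S)
    (x : Fin n → Model T R ω) (p : Position (fun j : Fin i => T j) n) :
    code i x (Fin.castLE hS (Fintype.equivFin _ p)) = value x p := by
  simp [code]

theorem code_ne_zero {i n : ℕ} (hS : Fintype.card (Position (fun j : Fin i => T j) n) ≤ S)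
    (hN : 0 < N) (x : Fin n → Model T R ω) : code i x ≠ fun _ => 0 := fun h => by
  have hmark : truthColour True = (0 : Fin (N + 1)) :=
    (code_equivFin hS x .mark).symm.trans (congrFun h _)
  have hzero : (0 : Fin (N + 1)) = truthColour False := by simp [truthColour]
  simpa using (truthColour_eq_iff hN).1 (hmark.trans hzero)

theorem col_eq_of_view {i : ℕ} {x : Model T R ω} {y : Model T R' ω} (h : x.view i = y.view i) :
    x.col = y.col := by
  cases x with
  | chain c => rw [(eq_chain_iff_of_view h c).1 rfl, col, col]
  | vert l hl b =>
    obtain ⟨l', hl', b', rfl, hcol, -⟩ := exists_vert_of_view h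
    exact hcol.symm

theorem kind_eq_iff_of_view {i j : ℕ} (hj : j < i) {x : Model T R ω} {y : Model T R' ω}
    (h : x.view i = y.view i) (special : Bool) (q : ℕ) :
    x.kind = some (j, special, q) ↔ y.kind = some (j, special, q) := by
  cases x with
  | chain c => rw [(eq_chain_iff_of_view h c).1 rfl, kind, kind]
  | vert l hl b =>
    obtain ⟨l', hl', b', rfl, -, rfl | hle⟩ := exists_vert_of_view h
    · rfl
    · simp only [kind, Option.some_inj, Prod.mk.injEq]
      omega

theorem entry_eq_of_view {i j : ℕ} (hj : j < i) {x : Model T R ω} {y : Model T R' ω}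
    (h : x.view i = y.view i) (p : ℕ) : x.entry j p = y.entry j p := by
  by_cases hx : ∀ q, x.kind ≠ some (j, true, q)
  · rw [entry_eq_col hx, col_eq_of_view h,
      entry_eq_col fun q => (kind_eq_iff_of_view hj h true q).not.1 (hx q)]
  · push Not at hx
    obtain ⟨q, hq⟩ := hx
    cases x with
    | chain c => cases hq
    | vert l hl b =>
      obtain ⟨l', hl', b', rfl, -, rfl | hle⟩ := exists_vert_of_view h
      · rfl
      · simp only [kind, Option.some_inj, Prod.mk.injEq] at hq
        omega

theorem code_eq_of_alike {i n : ℕ} {x : Fin n → Model T R ω} {y : Fin n → Model T R' ω}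
    (h : Alike i x y) : code i x = code i y := by
  have hvalue (p) : value (i := i) x p = value y p := by
    cases p with
    | mark => rfl
    | eq s s' => exact congrArg truthColour (propext (h.eq_iff s s'))
    | samePart s s' => exact congrArg truthColour (propext (h.part_eq_iff s s'))
    | edge s s' => exact congrArg truthColour (propext (h.edge_iff s s'))
    | kind s j special q =>
      exact congrArg truthColour (propext (kind_eq_iff_of_view j.2 (h.view_eq s) special q))
    | col s => exact col_eq_of_view (h.view_eq s)
    | entry s j p => exact entry_eq_of_view j.2 (h.view_eq s) p
  funext p
  simp only [code, hvalue]

theorem label_eq_of_kind_eq (hG : Admissible T R ω) (hG' : Admissible T R' ω) {l l' : Label N S}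
    {hl : l.Valid T R} {hl' : l'.Valid T R'} {b b' : Fin B}
    (hkind : (vert l hl b : Model T R ω).kind = (vert l' hl' b' : Model T R' ω).kind)
    (hcol : l.col = l'.col)
    (hentry : ∀ p < 2 * T l.part, (vert l hl b : Model T R ω).entry l.part p =
      (vert l' hl' b' : Model T R' ω).entry l.part p) : l = l' := by
  simp only [kind, Option.some_inj, Prod.mk.injEq, Fin.val_inj] at hkind
  obtain ⟨hpart, hsome, hidx⟩ := hkind
  suffices htuple : l.tuple = l'.tuple by
    cases l
    cases l'
    simp_all
  cases hu : l.tuple with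
  | none =>
    rw [hu] at hsome
    exact (Option.not_isSome_iff_eq_none.1 (by simp [← hsome])).symm
  | some u =>
    rw [hu] at hsome
    obtain ⟨u', hu'⟩ := Option.isSome_iff_exists.1 hsome.symm
    rw [hu', Option.some_inj]
    funext p
    by_cases hp : p.1 < 2 * T l.part
    · simpa only [entry_special hu rfl p.2, entry_special hu' (congrArg _ hpart.symm) p.2]
        using hentry p hp
    · rw [hG.support _ _ (hl.of_some hu).2.1 p (not_lt.1 hp),
        hG'.support _ _ (hl'.of_some hu').2.1 p (hpart ▸ not_lt.1 hp)]

theorem view_eq_of_kind_eq_iff (hG : Admissible T R ω) (hG' : Admissible T R' ω) {i : ℕ}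
    {x : Model T R ω} {y : Model T R' ω} (hloop : Edge x x ↔ Edge y y)
    (hkind : ∀ j < i, ∀ special, ∀ q < 2 * T j,
      x.kind = some (j, special, q) ↔ y.kind = some (j, special, q))
    (hcol : x.col = y.col) (hentry : ∀ j < i, ∀ p < 2 * T j, x.entry j p = y.entry j p) :
    x.view i = y.view i := by
  rw [edge_self_iff, edge_self_iff] at hloop
  cases x with
  | chain c =>
    cases y with
    | chain c' => exact congrArg Sum.inl hcol
    | vert l' hl' b' => simp at hloop
  | vert l hl b =>
    cases y with
    | chain c' => simp at hloop
    | vert l' hl' b' =>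
      by_cases hi : l.part.1 < i
      · have hkind' := (hkind _ hi _ _ hl.idx_lt).1 rfl
        rw [view_vert_of_lt hi, view_vert_of_lt (label_eq_of_kind_eq hG hG' hkind'.symm hcol
          (hentry _ hi) ▸ hi), label_eq_of_kind_eq hG hG' hkind'.symm hcol (hentry _ hi)]
      · have hi' : i ≤ l'.part.1 := by
          by_contra! hi'
          have hkind' := (hkind _ hi' _ _ hl'.idx_lt).2 rfl
          simp only [kind, Option.some_inj, Prod.mk.injEq] at hkind'
          omega
        rw [view_vert_of_le (not_lt.1 hi), view_vert_of_le hi']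
        exact congrArg (Sum.inr ∘ Sum.inr) hcol

theorem alike_of_code_eq (hG : Admissible T R ω) (hG' : Admissible T R' ω) (hN : 0 < N) {i n : ℕ}
    (hS : Fintype.card (Position (fun j : Fin i => T j) n) ≤ S) {x : Fin n → Model T R ω}
    {y : Fin n → Model T R' ω} (h : code i x = code i y) : Alike i x y := by
  have hvalue (p) : value (i := i) x p = value y p := by
    rw [← code_equivFin hS x, h, code_equivFin]
  have hedge (s s') : Edge (x s) (x s') ↔ Edge (y s) (y s') :=
    (truthColour_eq_iff hN).1 (hvalue (.edge s s'))
  refine ⟨fun s => view_eq_of_kind_eq_iff hG hG' (hedge s s) ?_ (hvalue (.col s)) ?_,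
    fun s s' => (truthColour_eq_iff hN).1 (hvalue (.eq s s')),
    fun s s' => (truthColour_eq_iff hN).1 (hvalue (.samePart s s')), hedge⟩
  · exact fun j hj special q hq =>
      (truthColour_eq_iff hN).1 (hvalue (.kind s ⟨j, hj⟩ special ⟨q, hq⟩))
  · exact fun j hj p hp => hvalue (.entry s ⟨j, hj⟩ ⟨p, hp⟩)

end Model

end Codes

section DefinabilityOfCodes

namespace Model

variable {N S B : ℕ} {T : ℕ → ℕ} {R : Record N S}
  {ω : Label N S × Fin B → Label N S × Fin B → Bool}

theorem kind_eq_special_iff (hG : Admissible T R ω) {j : Fin (N + 1)} (q : Fin (2 * T j))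
    (x : Model T R ω) :
    x.kind = some (j.1, true, q.1) ↔ x.part = some j.1 ∧
      ∃ z : Fin (2 * T j) → Model T R ω, IsTransitiveTournament z ∧ z q = x := by
  constructor
  · intro hx
    cases x with
    | chain c => cases hx
    | vert l hl b =>
      simp only [kind, Option.some_inj, Prod.mk.injEq, Fin.val_inj] at hx
      obtain ⟨rfl, hsome, hq⟩ := hx
      obtain ⟨u, hu⟩ := Option.isSome_iff_exists.1 hsome
      obtain ⟨b', hb', hz⟩ := exists_isTransitiveTournament hG (hl.of_some hu).2.1 q b
      refine ⟨rfl, _, hz, ?_⟩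
      have hidx : Fin.castLE (hG.two_mul_le _) q = l.idx := Fin.ext hq.symm
      simp only [hb', hidx, ← hl.eq_special hu]
  · rintro ⟨hpart, z, hz, rfl⟩
    obtain ⟨u, -, hu⟩ := hz.exists_eq_special hG hpart
    obtain ⟨_, _, hzq⟩ := hu q
    rw [hzq]
    rfl

theorem lt_of_kind_eq {j q : ℕ} {special : Bool} {x : Model T R ω}
    (h : x.kind = some (j, special, q)) : q < 2 * T j := by
  cases x with
  | chain c => cases h
  | vert l hl b => cases h; exact hl.idx_lt

theorem exists_isTransitiveTournament_edge (hG : Admissible T R ω) {l : Label N S}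
    (hl : l.Valid T R) (b : Fin B) (hnone : l.tuple = none) {q : Fin (2 * T l.part)}
    (hq : q.1 < T l.part) (hne : l.idx.1 ≠ q.1) :
    ∃ z : Fin (2 * T l.part) → Model T R ω,
      IsTransitiveTournament z ∧ Edge (vert l hl b) (z q) := by
  have hS := hG.two_mul_le l.part
  have hlink : l.Linked T (.special l.part (fun _ => 0) (Fin.castLE hS q)) :=
    (Label.linked_iff_of_none (.inl hnone)).2 ⟨rfl, by
      rwa [Nat.mod_eq_of_lt (hl.idx_lt_of_none hnone), Label.special, Fin.val_castLE,
        Nat.mod_eq_of_lt hq]⟩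
  obtain ⟨w, hw⟩ := exists_vert_edge_iff hG.universal (n := 1) (by omega)
    (fun _ => (vert l hl b : Model T R ω)) (fun _ => True) (fun _ => True)
    (Label.valid_special (p := Fin.castLE hS q) q.2 (hG.record_zero l.part))
  obtain ⟨b', rfl, hz⟩ := exists_isTransitiveTournament hG (hG.record_zero l.part) q w
  exact ⟨_, hz, ((hw 0).2 l hl b rfl).2.2 ⟨hlink, trivial⟩⟩

theorem kind_eq_ordinary_iff (hG : Admissible T R ω) {j : Fin (N + 1)} (q : Fin (2 * T j))
    (x : Model T R ω) : x.kind = some (j.1, false, q.1) ↔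
      x.part = some j.1 ∧ q.1 < T j ∧ ∀ z : Fin (2 * T j) → Model T R ω,
        IsTransitiveTournament z → (∀ p, z p ≠ x) ∧ ¬ Edge x (z q) := by
  constructor
  · intro hx
    cases x with
    | chain c => cases hx
    | vert l hl b =>
      simp only [kind, Option.some_inj, Prod.mk.injEq, Fin.val_inj] at hx
      obtain ⟨rfl, hnone, hq⟩ := hx
      rw [Option.isSome_eq_false_iff, Option.isNone_iff_eq_none] at hnone
      refine ⟨rfl, hq ▸ hl.idx_lt_of_none hnone, fun z hz => ⟨fun p hzp => ?_, fun hedge => ?_⟩⟩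
      · have hspecial := (kind_eq_special_iff hG p (vert l hl b)).2 ⟨rfl, z, hz, hzp⟩
        simp [kind, hnone] at hspecial
      · have hpart := part_eq_of_edge hedge ((edge_self_iff _).not.1 (hz.not_edge_self q))
        obtain ⟨u, -, hu⟩ := hz.exists_eq_special hG hpart.symm
        obtain ⟨_, _, hzq⟩ := hu q
        rw [hzq, edge_vert_vert] at hedge
        exact hedge.1.idx_ne (Fin.ext hq)
  · rintro ⟨hpart, hq, hz⟩
    obtain ⟨l, hl, b, rfl, hj⟩ := exists_vert_of_part hpart
    obtain rfl := Fin.ext hj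
    have hnone : l.tuple = none := by
      by_contra hne
      obtain ⟨-, z, hz', hzx⟩ := (kind_eq_special_iff hG ⟨l.idx, hl.idx_lt⟩ (vert l hl b)).1
        (by rw [kind, Option.isSome_iff_ne_none.2 hne])
      exact (hz z hz').1 _ hzx
    suffices hidx : l.idx.1 = q.1 by rw [kind, hnone, hidx, Option.isSome_none]
    by_contra hidx
    obtain ⟨z, hz', hedge⟩ := exists_isTransitiveTournament_edge hG hl b hnone hq hidx
    exact (hz z hz').2 hedge

theorem eq_chain_zero_iff (y : Model T R ω) :
    y = chain 0 ↔ Edge y y ∧ ∀ z : Model T R ω, Edge z z → Edge y z := by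
  constructor
  · rintro rfl
    refine ⟨edge_chain_self 0, fun z hz => ?_⟩
    obtain ⟨c, rfl⟩ := exists_eq_chain_of_edge_self hz
    exact Fin.zero_le c
  · rintro ⟨hy, hmin⟩
    obtain ⟨c, rfl⟩ := exists_eq_chain_of_edge_self hy
    exact congrArg _ (le_antisymm (hmin (chain 0) (edge_chain_self 0)) (Fin.zero_le c))

theorem eq_chain_last_iff (y : Model T R ω) :
    y = chain (Fin.last N) ↔ Edge y y ∧ ∀ z : Model T R ω, Edge z z → Edge z y := by
  constructor
  · rintro rfl
    refine ⟨edge_chain_self _, fun z hz => ?_⟩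
    obtain ⟨c, rfl⟩ := exists_eq_chain_of_edge_self hz
    exact Fin.le_last c
  · rintro ⟨hy, hmax⟩
    obtain ⟨c, rfl⟩ := exists_eq_chain_of_edge_self hy
    exact congrArg _ (le_antisymm (Fin.le_last c) (hmax _ (edge_chain_self (Fin.last N))))

theorem eq_chain_col_iff (x y : Model T R ω) :
    y = chain x.col ↔ Edge y y ∧ Edge x y ∧ (Edge x x → y = x) := by
  cases x with
  | chain c =>
    refine ⟨?_, fun h => h.2.2 (edge_chain_self c)⟩
    rintro rfl
    exact ⟨edge_chain_self c, edge_chain_self c, fun _ => rfl⟩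
  | vert l hl b =>
    cases y with
    | chain c => simp [col, edge_self_iff, eq_comm]
    | vert l' hl' b' => simp [edge_self_iff]

theorem eq_chain_entry_iff (hG : Admissible T R ω) {j : Fin (N + 1)} {x : Model T R ω}
    {q : Fin (2 * T j)} (hx : x.kind = some (j.1, true, q.1)) (p : Fin (2 * T j))
    (y : Model T R ω) : y = chain (x.entry j p) ↔ Edge y y ∧
      ∃ z : Fin (2 * T j) → Model T R ω, IsTransitiveTournament z ∧ z q = x ∧ Edge (z p) y := by
  obtain ⟨hpart, z₀, hz₀, hz₀x⟩ := (kind_eq_special_iff hG q x).1 hx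
  have edge_entry {z : Fin (2 * T j) → Model T R ω} (hz : IsTransitiveTournament z)
      (hzx : z q = x) (c : Fin (N + 1)) : Edge (z p) (chain c) ↔ x.entry j p = c := by
    obtain ⟨u, -, hu⟩ := hz.exists_eq_special hG (hzx ▸ hpart)
    obtain ⟨_, _, hzp⟩ := hu p
    obtain ⟨hl, b, hzq⟩ := hu q
    have hentry : (vert _ hl b : Model T R ω).entry j p = u (Fin.castLE (hG.two_mul_le j) p) :=
      entry_special rfl rfl (p.2.trans_le (hG.two_mul_le j)) hl b
    rw [hzp, edge_vert_chain, ← hzx, hzq, hentry, Label.special]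
  constructor
  · rintro rfl
    exact ⟨edge_chain_self _, z₀, hz₀, hz₀x, (edge_entry hz₀ hz₀x _).2 rfl⟩
  · rintro ⟨hy, z, hz, hzx, hedge⟩
    obtain ⟨c, rfl⟩ := exists_eq_chain_of_edge_self hy
    exact congrArg _ ((edge_entry hz hzx c).1 hedge).symm

theorem record_iff (hG : Admissible T R ω) {j : Fin (N + 1)} {u : Fin S → Fin (N + 1)}
    (hu : ∀ p : Fin S, 2 * T j ≤ p.1 → u p = 0) :
    R j u ↔ ∃ z : Fin (2 * T j) → Model T R ω, IsTransitiveTournament z ∧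
      ∀ p, (z p).part = some j.1 ∧ Edge (z p) (chain (u (Fin.castLE (hG.two_mul_le j) p))) := by
  have hpos : 0 < 2 * T j := by have := hG.three_le j; omega
  constructor
  · intro hRu
    obtain ⟨w, -⟩ := exists_vert_edge_iff hG.universal (Nat.zero_le _) (fun s => s.elim0)
      (fun _ => True) (fun _ => True)
      (Label.valid_special (p := ⟨0, hpos.trans_le (hG.two_mul_le j)⟩) hpos (hG.record_zero j))
    obtain ⟨b, -, hz⟩ := exists_isTransitiveTournament hG hRu ⟨0, hpos⟩ w
    exact ⟨_, hz, fun p => ⟨rfl, rfl⟩⟩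
  · rintro ⟨z, hz, hzu⟩
    obtain ⟨u', hRu', hu'⟩ := hz.exists_eq_special hG (hzu ⟨0, hpos⟩).1
    suffices u = u' from this ▸ hRu'
    funext p
    rcases lt_or_ge p.1 (2 * T j) with hp | hp
    · obtain ⟨_, _, hzp⟩ := hu' ⟨p, hp⟩
      have hedge := (hzu ⟨p, hp⟩).2
      rw [hzp] at hedge
      exact ((edge_vert_chain ..).1 hedge).symm
    · rw [hu p hp, hG.support j u' hRu' p hp]

end Model

namespace UniformlyDefinable

variable {ι : Type*} {α : Type}

section

variable {G : ι → Type*} [∀ k, Language.graph.Structure (G k)]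

theorem isTransitiveTournament {m : ℕ} (x : Fin m → α) :
    UniformlyDefinable Language.graph G fun k (a : α → G k) =>
      IsTransitiveTournament fun p => a (x p) :=
  ((forall_index fun p => (edge (x p) (x p)).not).and <| forall_index fun p => forall_index
    fun q => (const (p < q)).imp (edge (x p) (x q))).congr fun _ _ =>
      ⟨fun h => ⟨h.1, h.2⟩, fun h => ⟨h.1, h.2⟩⟩

theorem samePart (x y : α) :
    UniformlyDefinable Language.graph G fun k (a : α → G k) => SamePart (a x) (a y) :=
  (edge x x).not.and <| (edge y y).not.and <| exists_elem <|
    (edge _ _).not.and <| (edge _ _).and (edge _ _)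

theorem hasTournament (m : ℕ) (x : α) :
    UniformlyDefinable Language.graph G fun k (a : α → G k) => HasTournament m (a x) :=
  exists_tuple <| (isTransitiveTournament _).and <| forall_index fun _ => samePart _ _

theorem hasMaxTournament (m : ℕ) (x : α) :
    UniformlyDefinable Language.graph G fun k (a : α → G k) => HasMaxTournament m (a x) :=
  (hasTournament m x).and (hasTournament (m + 1) x).not

end

open Model

variable {N S B : ι → ℕ} {T : ℕ → ℕ} {R : ∀ k, Record (N k) (S k)}
  {ω : ∀ k, Label (N k) (S k) × Fin (B k) → Label (N k) (S k) × Fin (B k) → Bool}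

theorem part_eq_some (hG : ∀ k, Admissible T (R k) (ω k)) (j : ℕ) (x : α) :
    UniformlyDefinable Language.graph (fun k => Model T (R k) (ω k)) fun _ a =>
      (a x).part = some j :=
  (hasMaxTournament (2 * T j) x).congr fun k a => (hasMaxTournament_iff (hG k) (a x) j).symm

theorem part_eq (hG : ∀ k, Admissible T (R k) (ω k)) (x y : α) :
    UniformlyDefinable Language.graph (fun k => Model T (R k) (ω k)) fun _ a =>
      (a x).part = (a y).part := by
  refine ((samePart x y).or ((edge x x).and (edge y y))).congr fun k a => ?_
  rw [samePart_iff (hG k), edge_self_iff, edge_self_iff]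
  by_cases hx : (a x).part = none <;> simp [hx, eq_comm]

theorem kind_eq (hG : ∀ k, Admissible T (R k) (ω k)) {j : ℕ} (hj : ∀ k, j ≤ N k) (special : Bool)
    (q : Fin (2 * T j)) (x : α) :
    UniformlyDefinable Language.graph (fun k => Model T (R k) (ω k)) fun _ a =>
      (a x).kind = some (j, special, q.1) := by
  cases special with
  | true =>
    refine ((part_eq_some hG j x).and <| exists_tuple (R := fun k a (z : Fin (2 * T j) → _) =>
      IsTransitiveTournament z ∧ z q = a x) ?_).congr fun k a =>
        kind_eq_special_iff (hG k) (j := ⟨j, Nat.lt_succ_of_le (hj k)⟩) q (a x)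
    exact (isTransitiveTournament _).and (eq _ _)
  | false =>
    refine ((part_eq_some hG j x).and <| (const (q.1 < T j)).and <|
      forall_tuple (R := fun k a (z : Fin (2 * T j) → _) =>
        IsTransitiveTournament z → (∀ p, z p ≠ a x) ∧ ¬ Edge (a x) (z q)) ?_).congr fun k a =>
          kind_eq_ordinary_iff (hG k) (j := ⟨j, Nat.lt_succ_of_le (hj k)⟩) q (a x)
    exact (isTransitiveTournament _).imp <| (forall_index fun p => (eq _ _).not).and (edge _ _).not

theorem eq_chain_zero (y : α) :
    UniformlyDefinable Language.graph (fun k => Model T (R k) (ω k)) fun _ a => a y = chain 0 :=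
  ((edge y y).and <| forall_elem <| (edge _ _).imp (edge _ _)).congr fun _ a =>
    eq_chain_zero_iff (a y)

theorem eq_chain_truthColour {P : ∀ k, (α → Model T (R k) (ω k)) → Prop}
    (hP : UniformlyDefinable Language.graph (fun k => Model T (R k) (ω k)) P) (y : α) :
    UniformlyDefinable Language.graph (fun k => Model T (R k) (ω k)) fun k a =>
      a y = chain (truthColour (P k a)) := by
  have hlast : UniformlyDefinable Language.graph (fun k => Model T (R k) (ω k)) fun k a =>
      a y = chain (Fin.last (N k)) :=
    ((edge y y).and <| forall_elem <| (edge _ _).imp (edge _ _)).congr fun k a =>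
      eq_chain_last_iff (a y)
  refine ((hP.imp hlast).and (hP.not.imp (eq_chain_zero y))).congr fun k a => ?_
  by_cases h : P k a <;> simp [truthColour, h]

theorem eq_chain_col (x y : α) :
    UniformlyDefinable Language.graph (fun k => Model T (R k) (ω k)) fun _ a =>
      a y = chain (a x).col :=
  ((edge y y).and <| (edge x y).and <| (edge x x).imp (eq y x)).congr fun _ a =>
    eq_chain_col_iff (a x) (a y)

theorem eq_chain_entry (hG : ∀ k, Admissible T (R k) (ω k)) {j : ℕ} (hj : ∀ k, j ≤ N k)
    (p : Fin (2 * T j)) (x y : α) :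
    UniformlyDefinable Language.graph (fun k => Model T (R k) (ω k)) fun _ a =>
      a y = chain ((a x).entry j p) := by
  have hentry (q : Fin (2 * T j)) : UniformlyDefinable Language.graph
      (fun k => Model T (R k) (ω k)) fun k a => Edge (a y) (a y) ∧
        ∃ z : Fin (2 * T j) → Model T (R k) (ω k),
          IsTransitiveTournament z ∧ z q = a x ∧ Edge (z p) (a y) :=
    (edge y y).and <| exists_tuple <| (isTransitiveTournament _).and <| (eq _ _).and (edge _ _)
  have hspecial (q) := kind_eq hG hj true q x
  refine ((forall_index fun q => (hspecial q).imp (hentry q)).and <|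
    (forall_index fun q => (hspecial q).not).imp (eq_chain_col x y)).congr fun k a => ?_
  by_cases hx : ∃ q : Fin (2 * T j), (a x).kind = some (j, true, q.1)
  · have hiff (q : Fin (2 * T j)) (hq : (a x).kind = some (j, true, q.1)) :=
      eq_chain_entry_iff (hG k) (j := ⟨j, Nat.lt_succ_of_le (hj k)⟩) hq p (a y)
    obtain ⟨q, hq⟩ := hx
    exact ⟨fun h => ⟨fun q hq => (hiff q hq).1 h, fun hne => absurd hq (hne q)⟩,
      fun h => (hiff q hq).2 (h.1 q hq)⟩
  · rw [not_exists] at hx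
    have hne (q : ℕ) : (a x).kind ≠ some (j, true, q) := fun hq =>
      hx ⟨q, lt_of_kind_eq hq⟩ hq
    rw [entry_eq_col hne]
    exact ⟨fun h => ⟨fun q hq => absurd hq (hx q), fun _ => h⟩, fun h => h.2 hx⟩

theorem eq_chain_value (hG : ∀ k, Admissible T (R k) (ω k)) {i n : ℕ} (hi : ∀ k, i ≤ N k)
    (x : Fin n → α) (y : α) (p : Position (fun j : Fin i => T j) n) :
    UniformlyDefinable Language.graph (fun k => Model T (R k) (ω k)) fun _ a =>
      a y = chain (value (fun s => a (x s)) p) := by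
  have hlt (j : Fin i) (k) : j.1 ≤ N k := j.2.le.trans (hi k)
  cases p with
  | mark => exact eq_chain_truthColour (const _) y
  | eq s s' => exact eq_chain_truthColour (eq _ _) y
  | samePart s s' => exact eq_chain_truthColour (part_eq hG _ _) y
  | edge s s' => exact eq_chain_truthColour (edge _ _) y
  | kind s j special q => exact eq_chain_truthColour (kind_eq hG (hlt j) special q _) y
  | col s => exact eq_chain_col _ y
  | entry s j p => exact eq_chain_entry hG (hlt j) p _ y

theorem record_code (hG : ∀ k, Admissible T (R k) (ω k)) {i n : ℕ} (hi : ∀ k, i ≤ N k)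
    (hcard : Fintype.card (Position (fun j : Fin i => T j) n) ≤ 2 * T i) (x : Fin n → α) :
    UniformlyDefinable Language.graph (fun k => Model T (R k) (ω k)) fun k a =>
      R k i (code i fun s => a (x s)) := by
  have hzero (k) (a : α → Model T (R k) (ω k)) (p : Fin (S k)) (hp : 2 * T i ≤ p.1) :
      code i (fun s => a (x s)) p = 0 := dif_neg (hcard.trans hp).not_gt
  have hcode (p : Fin (2 * T i)) : UniformlyDefinable Language.graph
      (fun k => Model T (R k) (ω k)) fun k (a : (α ⊕ Fin (2 * T i)) ⊕ Unit → _) =>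
        a (.inr ()) = chain (code i (fun s => a (.inl (.inl (x s)))) (Fin.castLE
          ((hG k).two_mul_le ⟨i, Nat.lt_succ_of_le (hi k)⟩) p)) := by
    by_cases hp : p.1 < Fintype.card (Position (fun j : Fin i => T j) n)
    · simpa only [code, Fin.val_castLE, hp, dif_pos] using eq_chain_value hG hi
        (fun s => Sum.inl (Sum.inl (x s))) (Sum.inr ()) ((Fintype.equivFin _).symm ⟨p, hp⟩)
    · simpa only [code, Fin.val_castLE, hp, dif_neg, not_false_eq_true] using eq_chain_zero _
  refine .congr (R := fun k a => ∃ z : Fin (2 * T i) → Model T (R k) (ω k),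
    IsTransitiveTournament z ∧ ∀ p, (z p).part = some i ∧ ∃ y, y = chain (code i
      (fun s => a (x s)) (Fin.castLE ((hG k).two_mul_le ⟨i, Nat.lt_succ_of_le (hi k)⟩) p)) ∧
        Edge (z p) y) ?_ fun k a => by
      simpa only [exists_eq_left] using
        record_iff (hG k) (j := ⟨i, Nat.lt_succ_of_le (hi k)⟩) (hzero k a)
  exact exists_tuple <| (isTransitiveTournament _).and <| forall_index fun p =>
    (part_eq_some hG i _).and <| exists_elem <| (hcode p).and (edge _ _)

end UniformlyDefinable

end DefinabilityOfCodes

section Records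

variable {T n : ℕ → ℕ} (Q : ∀ i, Query Language.graph (n i)) {N S B : ℕ}
  (ω : Label N S × Fin B → Label N S × Fin B → Bool)

variable (T) in
/-- The records of the parts before number `i`, the others being trivial. Part `j` records the
codes of the tuples that satisfy the query number `j` in the model whose only records are those of
the parts before number `j`. -/
noncomputable def partialRecord : ℕ → Record N S
  | 0 => fun _ u => u = fun _ => 0
  | i + 1 => fun j u =>
      if j = i then (u = fun _ => 0) ∨ ∃ y : Fin (n i) → Model T (partialRecord i) ω,
        Model.code i y = u ∧ Q i _ y
      else partialRecord i j u

variable (T) in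
/-- The records of all parts together. -/
noncomputable def fullRecord : Record N S := fun j => partialRecord T Q ω (j + 1) j

theorem partialRecord_of_lt {i j : ℕ} (h : j < i) :
    partialRecord T Q ω i j = fullRecord T Q ω j := by
  induction i, Nat.succ_le_of_lt h using Nat.le_induction with
  | base => rfl
  | succ i hi ih =>
    rw [← ih hi]
    exact funext fun u => if_neg (Nat.lt_of_succ_le hi).ne

theorem partialRecord_of_le {i j : ℕ} (h : i ≤ j) :
    partialRecord T Q ω i j = fun u => u = fun _ => 0 := by
  induction i with
  | zero => rfl
  | succ i ih =>
    rw [← ih (Nat.le_of_succ_le h)]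
    exact funext fun u => if_neg (Nat.lt_of_succ_le h).ne'

theorem fullRecord_iff (i : ℕ) (u : Fin S → Fin (N + 1)) :
    fullRecord T Q ω i u ↔ (u = fun _ => 0) ∨ ∃ y : Fin (n i) → Model T (partialRecord T Q ω i) ω,
      Model.code i y = u ∧ Q i _ y :=
  iff_of_eq (if_pos rfl)

/-- A sequence `T` that grows fast enough for part `i`, with `T i` ordinary labels, to record the
query number `i`. -/
structure IsFast (T : ℕ → ℕ) {n : ℕ → ℕ} (Q : ∀ i, Query Language.graph (n i)) : Prop where
  three_le : ∀ i, 3 ≤ T i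
  strictMono : StrictMono T
  invariant : ∀ i, (Q i).IsPebbleInvariant (T i)
  arity_le : ∀ i, n i ≤ T i
  card_le : ∀ i, Fintype.card (Position (fun j : Fin i => T j) (n i)) ≤ 2 * T i

namespace IsFast

variable {Q} {ω} (hT : IsFast T Q) (hω : IsUniversal S ω) (hS : 2 * T N ≤ S)
include hT

theorem eq_zero_of_fullRecord {j : ℕ} {u : Fin S → Fin (N + 1)} (hu : fullRecord T Q ω j u)
    {p : Fin S} (hp : 2 * T j ≤ p.1) : u p = 0 := by
  rcases (fullRecord_iff Q ω j u).1 hu with rfl | ⟨y, rfl, -⟩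
  · rfl
  · exact dif_neg ((hT.card_le j).trans hp).not_gt

include hω hS

theorem admissible_fullRecord : Admissible T (fullRecord T Q ω) ω where
  universal := hω
  three_le := hT.three_le
  strictMono := hT.strictMono
  le := hS
  record_zero j := (fullRecord_iff Q ω j _).2 (.inl rfl)
  support _ _ hu _ := hT.eq_zero_of_fullRecord hu

theorem admissible_partialRecord (i : ℕ) : Admissible T (partialRecord T Q ω i) ω where
  universal := hω
  three_le := hT.three_le
  strictMono := hT.strictMono
  le := hS
  record_zero j := by
    rcases lt_or_ge j i with hj | hj
    · rw [partialRecord_of_lt Q ω hj]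
      exact (hT.admissible_fullRecord hω hS).record_zero j
    · rw [partialRecord_of_le Q ω hj]
  support j u hu p hp := by
    rcases lt_or_ge j i with hj | hj
    · exact hT.eq_zero_of_fullRecord (partialRecord_of_lt Q ω hj ▸ hu) hp
    · rw [partialRecord_of_le Q ω hj] at hu
      rw [hu]

/-- The records of the parts from number `i` on are invisible in the game with `T i` pebbles. -/
def pebbleSystem {i : ℕ} (hi : i + T i ≤ N + 1) : PebbleSystem Language.graph
    (Model T (fullRecord T Q ω) ω) (Model T (partialRecord T Q ω i) ω) (T i) :=
  have hTS (j : ℕ) (hj : j ≤ N) : T j ≤ S := by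
    have := hT.strictMono.monotone hj
    omega
  have hiN : i ≤ N := by
    have := hT.three_le i
    omega
  Model.pebbleSystem (i := i) hω (hTS i hiN) (fun j hj u => by rw [partialRecord_of_lt Q ω hj])
    (fun j hij hj => ⟨hT.strictMono.monotone hij, hTS j hj⟩) hi

theorem query_iff_record {i : ℕ} (hi : i + T i ≤ N + 1)
    (y : Fin (n i) → Model T (fullRecord T Q ω) ω) :
    Q i _ y ↔ fullRecord T Q ω i (Model.code i y) := by
  have hiN : i ≤ N ∧ 0 < N := by
    have := hT.three_le i
    omega
  have hcard : Fintype.card (Position (fun j : Fin i => T j) (n i)) ≤ S := (hT.card_le i).trans <|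
    (Nat.mul_le_mul_left 2 (hT.strictMono.monotone hiN.1)).trans hS
  have hquery (y') (h : Model.Alike i y y') : Q i _ y ↔ Q i _ y' :=
    hT.invariant i _ _ (hT.pebbleSystem hω hS hi) y y' h
  rw [fullRecord_iff]
  constructor
  · intro hy
    have hempty : Model.Alike i (Fin.elim0 : Fin 0 → Model T (fullRecord T Q ω) ω)
        (Fin.elim0 : Fin 0 → Model T (partialRecord T Q ω i) ω) :=
      ⟨fun s => s.elim0, fun s => s.elim0, fun s => s.elim0, fun s => s.elim0⟩
    obtain ⟨y', h⟩ := (hT.pebbleSystem hω hS hi).exists_rel hempty (hT.arity_le i) y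
    exact .inr ⟨y', (Model.code_eq_of_alike h).symm, (hquery y' h).1 hy⟩
  · rintro (hzero | ⟨y', hcode, hy'⟩)
    · exact absurd hzero (Model.code_ne_zero hcard hiN.2 y)
    · exact (hquery y' (Model.alike_of_code_eq (hT.admissible_fullRecord hω hS)
        (hT.admissible_partialRecord hω hS i) hiN.2 hcard hcode.symm)).2 hy'

end IsFast

end Records

section Construction

/-- The strictly increasing sequence `T` whose member `T i` is chosen larger than the bound `c i`
which depends on the members before it. -/
def fastSequence (c : ∀ i, (Fin i → ℕ) → ℕ) (i : ℕ) : ℕ :=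
  c i (fun j => fastSequence c j) + ∑ j : Fin i, fastSequence c j + 1
termination_by i
decreasing_by all_goals exact j.2

theorem le_fastSequence (c : ∀ i, (Fin i → ℕ) → ℕ) (i : ℕ) :
    c i (fun j => fastSequence c j) ≤ fastSequence c i := by
  rw [fastSequence]
  omega

theorem strictMono_fastSequence (c : ∀ i, (Fin i → ℕ) → ℕ) : StrictMono (fastSequence c) :=
  fun j i hji => by
    have : fastSequence c j ≤ ∑ j : Fin i, fastSequence c j :=
      Finset.single_le_sum (f := fun j : Fin i => fastSequence c j)
        (fun _ _ => Nat.zero_le _) (Finset.mem_univ ⟨j, hji⟩)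
    rw [fastSequence.eq_def c i]
    omega

variable {n : ℕ → ℕ} {Q : ∀ i, Query Language.graph (n i)}

theorem exists_isFast (hQ : ∀ i, ∃ K, (Q i).IsPebbleInvariant K) : ∃ T, IsFast T Q := by
  choose K hK using hQ
  let c (i : ℕ) (t : Fin i → ℕ) : ℕ := 3 + K i + n i + Fintype.card (Position t (n i))
  have hc (i : ℕ) : 3 + K i + n i +
      Fintype.card (Position (fun j : Fin i => fastSequence c j) (n i)) ≤ fastSequence c i :=
    le_fastSequence c i
  refine ⟨fastSequence c, fun i => ?_, strictMono_fastSequence c, fun i => (hK i).mono ?_,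
    fun i => ?_, fun i => ?_⟩ <;> have := hc i <;> omega

/-- The number of vertices with each label in the model number `N`. -/
noncomputable def multiplicity (T : ℕ → ℕ) (N : ℕ) : ℕ :=
  (exists_isUniversal (Label N (2 * T N)) (2 * T N)).choose

/-- The universal relation of the model number `N`. -/
noncomputable def universalRel (T : ℕ → ℕ) (N : ℕ) :
    Label N (2 * T N) × Fin (multiplicity T N) → Label N (2 * T N) × Fin (multiplicity T N) →
      Bool :=
  (exists_isUniversal (Label N (2 * T N)) (2 * T N)).choose_spec.choose

theorem isUniversal_universalRel (T : ℕ → ℕ) (N : ℕ) :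
    IsUniversal (2 * T N) (universalRel T N) :=
  (exists_isUniversal (Label N (2 * T N)) (2 * T N)).choose_spec.choose_spec

/-- The sequence of digraphs of the theorem: the model number `N` has `N + 1` colours and `N + 1`
parts, and records the queries with numbers up to `N`. -/
noncomputable def digraph (T : ℕ → ℕ) (Q : ∀ i, Query Language.graph (n i)) (N : ℕ) :
    FinDigraph where
  carrier := Model T (fullRecord T Q (universalRel T N)) (universalRel T N)
  str := inferInstance
  fin := inferInstance
  nonempty := inferInstance

theorem uniformlyDefinable_query {T : ℕ → ℕ} (hT : IsFast T Q) (i : ℕ) :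
    UniformlyDefinable Language.graph (fun N => (digraph T Q N).carrier) fun _ a => Q i _ a := by
  refine .of_eventually (digraph T Q) (fun _ _ f a => (hT.invariant i).iff_of_equiv f a)
    (i + T i) ?_
  have hrecord := UniformlyDefinable.record_code
    (fun N : {N // i + T i ≤ N} => hT.admissible_fullRecord (isUniversal_universalRel T N) le_rfl)
    (fun N => (Nat.le_add_right _ _).trans N.2) (hT.card_le i) id
  exact hrecord.congr fun N a =>
    hT.query_iff_record (isUniversal_universalRel T N) le_rfl (N.2.trans N.1.le_succ) a

theorem exists_formula_of_isoClass {G : ℕ → FinDigraph} {m K : ℕ} {P : Query Language.graph m}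
    (hP : P.IsPebbleInvariant K)
    (h : UniformlyDefinable Language.graph (fun N => (G N).carrier) fun _ a => P _ a) :
    ∃ ψ : Language.graph.Formula (Fin m), ∀ M ∈ isoClass G, ∀ a : Fin m → M.carrier,
      P M.carrier a ↔ ψ.Realize a := by
  obtain ⟨ψ, hψ⟩ := h
  refine ⟨ψ, ?_⟩
  rintro M ⟨N, ⟨f⟩⟩ a
  exact (hP.iff_of_equiv f a).trans
    ((hψ N (f ∘ a)).trans (StrongHomClass.realize_formula f ψ))

end Construction

section UnboundedInduction

/-- The formula `φ(P, x)` saying that `x` has a loop and that `P` holds for all predecessors of `x`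
that have a loop and differ from `x`. Its stages climb the chain of a model step by step. -/
def chainFml : Fml Language.graph [1] (0 + 1) :=
  .and (.rel adj ![.var 0, .var 0])
    (.neg (.ex (.and (.rel adj ![.var 1, .var 1]) (.and (.rel adj ![.var 1, .var 0])
      (.and (.neg (.equal (.var 1) (.var 0))) (.neg (.relVar (0 : Fin 1) fun _ => .var 1)))))))

theorem relMap_realize_var {M : Type*} [Language.graph.Structure M] {n : ℕ} (b : Fin n → M)
    (i j : Fin n) :
    (RelMap adj fun l => Term.realize b
      ((![.var i, .var j] : Fin 2 → Language.graph.Term (Fin n)) l)) ↔ Edge (b i) (b j) :=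
  iff_of_eq (congrArg _ (by ext l; fin_cases l <;> rfl))

theorem mem_operator_chainFml {M : Type*} [Language.graph.Structure M] (a : Fin 0 → M)
    (P : Set (Fin 1 → M)) (x : Fin 1 → M) :
    x ∈ chainFml.operator a P ↔ Edge (x 0) (x 0) ∧
      ∀ z, Edge z z → Edge z (x 0) → z ≠ x 0 → (fun _ => z) ∈ P := by
  have hx : (Fin.append a x : Fin (0 + 1) → M) 0 = x 0 := Fin.append_right a x 0
  have hsnoc_zero (z) : (Fin.snoc (Fin.append a x) z : Fin (0 + 1 + 1) → M) 0 = x 0 :=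
    (Fin.snoc_castSucc (α := fun _ => M) z _ 0).trans hx
  have hsnoc_one (z) : (Fin.snoc (Fin.append a x) z : Fin (0 + 1 + 1) → M) 1 = z :=
    Fin.snoc_last (α := fun _ => M) z _
  change Fml.Realize _ _ _ ↔ _
  simp only [chainFml, Fml.Realize, relMap_realize_var, Term.realize_var, hx, hsnoc_zero, hsnoc_one]
  push Not
  rfl

theorem stage_chainFml {N S B : ℕ} {T : ℕ → ℕ} {R : Record N S}
    {ω : Label N S × Fin B → Label N S × Fin B → Bool} (a : Fin 0 → Model T R ω) (k : ℕ) :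
    stage (chainFml.operator a) k = {x | ∃ c : Fin (N + 1), c.1 < k ∧ x 0 = .chain c} := by
  induction k with
  | zero => simp [stage]
  | succ k ih =>
    ext x
    rw [stage, mem_operator_chainFml, ih]
    simp only [Set.mem_ofPred_eq]
    constructor
    · rintro ⟨hx, hpred⟩
      obtain ⟨c, hc⟩ := Model.exists_eq_chain_of_edge_self hx
      refine ⟨c, ?_, hc⟩
      by_contra! hlt
      let d : Fin (N + 1) := ⟨k, by omega⟩
      have hdc : d < c := Nat.lt_of_succ_le hlt
      obtain ⟨c', hc', hd⟩ := hpred (.chain d) (Model.edge_chain_self d)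
        (hc ▸ hdc.le) (by simpa only [hc, ne_eq, Model.chain.injEq] using hdc.ne)
      cases hd
      exact lt_irrefl _ hc'
    · rintro ⟨c, hc, hx⟩
      rw [hx]
      refine ⟨Model.edge_chain_self c, fun z hz hzc hne => ?_⟩
      obtain ⟨c', rfl⟩ := Model.exists_eq_chain_of_edge_self hz
      have hlt : c' < c := lt_of_le_of_ne hzc fun h => hne (congrArg _ h)
      exact ⟨c', by omega, rfl⟩

theorem not_inductionsBounded_digraph (T : ℕ → ℕ) {n : ℕ → ℕ}
    (Q : ∀ i, Query Language.graph (n i)) : ¬ InductionsBounded (isoClass (digraph T Q)) := by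
  intro h
  obtain ⟨j, hj⟩ := h 0 1 chainFml (by simp [chainFml, Fml.IsFO])
    (by simp [chainFml, Fml.Polarity])
  let a : Fin 0 → Model T (fullRecord T Q (universalRel T j)) (universalRel T j) := Fin.elim0
  have hstable : stage (chainFml.operator a) j = ⋃ k, stage (chainFml.operator a) k :=
    hj (digraph T Q j) ⟨j, ⟨Language.Equiv.refl _ _⟩⟩ a
  have hlast : (fun _ => .chain (Fin.last j)) ∈ stage (chainFml.operator a) (j + 1) := by
    rw [stage_chainFml]
    exact ⟨Fin.last j, j.lt_succ_self, rfl⟩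
  have hj : (fun _ => .chain (Fin.last j)) ∈ stage (chainFml.operator a) j :=
    hstable ▸ Set.mem_iUnion_of_mem (j + 1) hlast
  rw [stage_chainFml] at hj
  obtain ⟨c, hc, hcj⟩ := hj
  cases hcj
  exact lt_irrefl _ hc

end UnboundedInduction

end McColm

theorem mainTheorem1_general {ι : Type*} [Countable ι] (n : ι → ℕ)
    (Q : ∀ i, McColm.Query FirstOrder.Language.graph (n i))
    (hQ : ∀ i, ∃ K, (Q i).IsPebbleInvariant K) :
    ∃ G : ℕ → McColm.FinDigraph,
      ¬ McColm.InductionsBounded (McColm.isoClass G) ∧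
      ∀ i, ∃ ψ : FirstOrder.Language.graph.Formula (Fin (n i)),
        ∀ M ∈ McColm.isoClass G, ∀ a : Fin (n i) → M.carrier,
          Q i M.carrier a ↔ ψ.Realize a := by
  let query : Option ι → Σ n, McColm.Query FirstOrder.Language.graph n :=
    fun o => o.elim ⟨0, fun _ _ _ => True⟩ fun i => ⟨n i, Q i⟩
  have hquery (o : Option ι) : ∃ K, (query o).2.IsPebbleInvariant K := by
    cases o with
    | none => exact ⟨0, fun _ _ _ _ _ _ _ _ => Iff.rfl⟩
    | some i => exact hQ i
  obtain ⟨enum, henum⟩ := exists_surjective_nat (Option ι)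
  obtain ⟨T, hT⟩ := McColm.exists_isFast fun k => hquery (enum k)
  let G := McColm.digraph T fun k => (query (enum k)).2
  have hdef (o : Option ι) : ∃ ψ : FirstOrder.Language.graph.Formula (Fin (query o).1),
      ∀ M ∈ McColm.isoClass G, ∀ a, (query o).2 M.carrier a ↔ ψ.Realize a := by
    obtain ⟨k, rfl⟩ := henum o
    exact McColm.exists_formula_of_isoClass (hT.invariant k) (McColm.uniformlyDefinable_query hT k)
  exact ⟨G, McColm.not_inductionsBounded_digraph T _, fun i => hdef (some i)⟩

theorem mainTheorem1 :
    ∃ G : ℕ → McColm.FinDigraph,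
      ¬ McColm.InductionsBounded (McColm.isoClass G) ∧
      McColm.LFPCollapsesToFO (McColm.isoClass G) := by
  obtain ⟨G, hG, hdef⟩ := mainTheorem1_general (ι := Σ n, McColm.Fml FirstOrder.Language.graph [] n)
    (fun φ => φ.1) (fun φ => φ.2.query) fun φ => ⟨_, φ.2.isPebbleInvariant_query⟩
  exact ⟨G, hG, fun n φ _ => hdef ⟨n, φ⟩⟩
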